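/- Let $(M,g)$ be a smooth Riemannian manifold without boundary (Hausdorff, second countable, of dimension $d\ge 0$, not necessarily compact), let $dy$ be its Riemannian volume and let $L^2(M)$ be the Hilbert space of real- or complex-valued square-integrable functions. A bounded operator $S$ on $L^2(M)$ is called a \emph{smoothing operator} if there is a function $K_S\in C^\infty(M\times M)$, its \emph{kernel}, such that $K_S(x,\cdot)$ and $K_S(\cdot,x)$ are in $L^2(M)$ for every $x\in M$, such that for all $u\in L^2(M)$ \[ (Su)(x)=\int_M K_S(x,y)\,u(y)\,dy,\qquad (S^{*}u)(x)=\int_M \overline{K_S(y,x)}\,u(y)\,dy \] for almost every $x$, and such that the right-hand sides are $C^\infty$ functions of $x\in M$ (so $S$ and $S^*$ map $L^2(M)$ into $C^\infty(M)$). For a compact set $U\subset M\times M$, $k\in\mathbb{N}$ and $v\in C^\infty(M\times M)$ let \[ p_{U,k}(v)=\sup_{(x,y)\in U}|\nabla^k v(x,y)|, \] where $\nabla$ is the Levi-Civita connection of the Riemannian product $(M\times M,g\oplus g)$ acting on covariant tensor fields and $|\cdot|$ is the norm on covariant tensors induced by $g\oplus g$. For any exhaustion $\{U_j\}_{j\in\mathbb{N}}$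 of $M\times M$ by compact subsets ($U_j\subset \operatorname{int}U_{j+1}$, $\bigcup_j U_j=M\times M$) give $C^\infty(M\times M)$ the Fréchet topology of the seminorms $p_{U_j,k}$, $j,k\in\mathbb{N}$. Let $S$ be a compact smoothing operator on $L^2(M)$ with operator norm $\|S\|<1$. Then: (1) for every $n\ge 1$ the operator $S^n$ is a smoothing operator, and its kernel $K_{S^n}\in C^\infty(M\times M)$ is unique; (2) the series $S'=\sum_{n\ge1}S^n$ converges in operator norm, and $I+S'$ is the two-sided inverse of $I-S$, i.e. $(I-S)^{-1}=I+S'$; (3) $S'$ is a smoothing operator, and the series $\sum_{n\ge 1}K_{S^n}$ converges in $C^\infty(M\times M)$ to a kernel $K_{S'}$ of $S'$. -/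

import Mathlib

open Set Filter Topology MeasureTheory Manifold Bundle
open scoped ENNReal ContDiff ComplexConjugate

noncomputable section

namespace NeumannSmoothing

/-! ### Covariant derivatives of functions on a Riemannian manifold

`N` is a manifold without boundary, modelled on the finite-dimensional space `F`, and `B` is a
(smooth) field of inner products on its tangent spaces. -/

section Covariant

variable {F : Type*} [NormedAddCommGroup F] [NormedSpace ℝ F]
  {H : Type*} [TopologicalSpace H] (I : ModelWithCorners ℝ F H)
  {N : Type*} [TopologicalSpace N] [ChartedSpace H N]
  {𝕜 : Type*} [RCLike 𝕜]

/-- The coordinate expression, in the preferred chart `φ` around `p`, of the field `B` of bilinear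
forms on tangent spaces: `(u, w) ↦ B (Dφ⁻¹ u, Dφ⁻¹ w)` at `φ⁻¹ y`, for `y` in the target of `φ`.
(All tangent spaces are copies of the model space `F`.) -/
def chartMetric (B : ∀ q : N, TangentSpace I q →L[ℝ] TangentSpace I q →L[ℝ] ℝ) (p : N) (y : F) :
    F →L[ℝ] F →L[ℝ] ℝ :=
  let A : F →L[ℝ] F := mfderiv 𝓘(ℝ, F) I (extChartAt I p).symm y
  let b : F →L[ℝ] F →L[ℝ] ℝ := B ((extChartAt I p).symm y)
  b.bilinearComp A A

/-- The Christoffel symbols `Γ y (u, w)` of the Levi-Civita connection of a metric `G` on (an open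
subset of) `F`, i.e. the vector determined by
`2 G(Γ(u, w), z) = (D_u G)(w, z) + (D_w G)(u, z) - (D_z G)(u, w)` for all `z`. -/
def christoffel (G : F → F →L[ℝ] F →L[ℝ] ℝ) (y u w : F) : F :=
  (G y).inverse ((1 / 2 : ℝ) •
    (fderiv ℝ G y u w + fderiv ℝ G y w u - ((fderiv ℝ G y).flip u).flip w))

/-- The `k`-th covariant derivative `∇ᵏ f` of a function `f` on (an open subset of) `F`, a covariant
`k`-tensor field, for the Levi-Civita connection of the metric `G`:
`(∇ᵏ⁺¹ f)(w₀, …, w_k) = D_{w₀} (∇ᵏ f (w₁, …, w_k)) - ∑ᵢ ∇ᵏ f (w₁, …, Γ(w₀, wᵢ), …, w_k)`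
for constant vector fields `w₀, …, w_k`. -/
def iteratedCovDeriv (G : F → F →L[ℝ] F →L[ℝ] ℝ) (f : F → 𝕜) :
    (k : ℕ) → F → (Fin k → F) → 𝕜
  | 0, y, _ => f y
  | k + 1, y, w =>
      fderiv ℝ (fun z => iteratedCovDeriv G f k z (Fin.tail w)) y (w 0) -
        ∑ i : Fin k, iteratedCovDeriv G f k y
          (Function.update (Fin.tail w) i (christoffel G y (w 0) (Fin.tail w i)))

/-- The pointwise norm `|∇ᵏ v|` at `p`, computed in the preferred chart around `p`. The norm of
a covariant tensor `T` is `(∑ |T(e_{i₁}, …, e_{i_k})|²)^{1/2}` for an orthonormal basis `e` of the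
tangent space; all orthonormal bases give the same value, and so the supremum over them
is that value. -/
def covDerivNorm (B : ∀ q : N, TangentSpace I q →L[ℝ] TangentSpace I q →L[ℝ] ℝ) (v : N → 𝕜)
    (k : ℕ) (p : N) : ℝ≥0∞ :=
  ⨆ e : {e : Fin (Module.finrank ℝ F) → F // ∀ i j,
      chartMetric I B p (extChartAt I p p) (e i) (e j) = if i = j then 1 else 0},
    ENNReal.ofReal (Real.sqrt (∑ i : Fin k → Fin (Module.finrank ℝ F),
      ‖iteratedCovDeriv (chartMetric I B p) (v ∘ (extChartAt I p).symm) k (extChartAt I p p)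
        (fun a => e.1 (i a))‖ ^ 2))

/-- The seminorm `sup_{p ∈ U} |∇ᵏ v|`. -/
def smoothSeminorm (B : ∀ q : N, TangentSpace I q →L[ℝ] TangentSpace I q →L[ℝ] ℝ) (U : Set N)
    (k : ℕ) (v : N → 𝕜) : ℝ≥0∞ :=
  ⨆ p ∈ U, covDerivNorm I B v k p

end Covariant

/-! ### Riemannian volume, product metric and smoothing operators -/

section Operators

variable {d : ℕ} {M : Type*} [TopologicalSpace M] [ChartedSpace (EuclideanSpace ℝ (Fin d)) M]
  [IsManifold (𝓡 d) ∞ M]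

/-- Smooth Riemannian metrics on the `d`-dimensional manifold `M`. -/
abbrev Metric (d : ℕ) (M : Type*) [TopologicalSpace M]
    [ChartedSpace (EuclideanSpace ℝ (Fin d)) M] [IsManifold (𝓡 d) ∞ M] :=
  ContMDiffRiemannianMetric (𝓡 d) ∞ (EuclideanSpace ℝ (Fin d))
    (fun x : M => TangentSpace (𝓡 d) x)

/-- The Riemannian product metric `g ⊕ g` on `M × M`. -/
def prodMetric (g : Metric d M) (p : M × M) :
    TangentSpace ((𝓡 d).prod (𝓡 d)) p →L[ℝ] TangentSpace ((𝓡 d).prod (𝓡 d)) p →L[ℝ] ℝ :=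
  let π₁ : EuclideanSpace ℝ (Fin d) × EuclideanSpace ℝ (Fin d) →L[ℝ] EuclideanSpace ℝ (Fin d) :=
    ContinuousLinearMap.fst ℝ _ _
  let π₂ : EuclideanSpace ℝ (Fin d) × EuclideanSpace ℝ (Fin d) →L[ℝ] EuclideanSpace ℝ (Fin d) :=
    ContinuousLinearMap.snd ℝ _ _
  let g₁ : EuclideanSpace ℝ (Fin d) →L[ℝ] EuclideanSpace ℝ (Fin d) →L[ℝ] ℝ := g.inner p.1
  let g₂ : EuclideanSpace ℝ (Fin d) →L[ℝ] EuclideanSpace ℝ (Fin d) →L[ℝ] ℝ := g.inner p.2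
  g₁.bilinearComp π₁ π₁ + g₂.bilinearComp π₂ π₂

variable [MeasurableSpace M]

/-- The Riemannian volume on the domain of the preferred chart around `x`, extended by zero: in
coordinates it is `√(det gᵢⱼ) dy`. -/
def chartVolume (g : Metric d M) (x : M) : Measure M :=
  ((volume.restrict (extChartAt (𝓡 d) x).target).withDensity fun y =>
    ENNReal.ofReal (Real.sqrt (Matrix.of fun i j : Fin d =>
      chartMetric (𝓡 d) g.inner x y (EuclideanSpace.single i 1) (EuclideanSpace.single j 1)).det)).map
    (extChartAt (𝓡 d) x).symm

/-- The Riemannian volume measure of `(M, g)`. The chart volumes agree on the overlaps of charts,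
so the measure that they glue to is the least measure which dominates all of them. -/
def riemannianVolume (g : Metric d M) : Measure M :=
  ⨆ x : M, chartVolume g x

/-- The Hilbert space `L²(M)` of real or complex functions, for the Riemannian volume. -/
abbrev L2 (𝕜 : Type*) [RCLike 𝕜] (g : Metric d M) :=
  Lp 𝕜 2 (riemannianVolume g)

variable {𝕜 : Type*} [RCLike 𝕜]

/-- `S` maps `L²(M)` into `C^∞(M)` and is the integral operator
`(S u)(x) = ∫ K(x, y) u(y) dy` (with an absolutely convergent integral for all `x` and
`u ∈ L²(M)`). -/
structure IsIntegralOperatorIntoSmooth (g : Metric d M) (K : M → M → 𝕜)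
    (S : L2 𝕜 g →L[𝕜] L2 𝕜 g) : Prop where
  memLp : ∀ x, MemLp (K x) 2 (riemannianVolume g)
  ae_eq : ∀ u : L2 𝕜 g,
    S u =ᵐ[riemannianVolume g] fun x => ∫ y, K x y * u y ∂riemannianVolume g
  contMDiff : ∀ u : L2 𝕜 g,
    ContMDiff (𝓡 d) 𝓘(ℝ, 𝕜) ∞ fun x => ∫ y, K x y * u y ∂riemannianVolume g

/-- The space `C^∞(M × M)`. -/
abbrev SmoothKernel (𝕜 : Type*) [RCLike 𝕜] (d : ℕ) (M : Type*) [TopologicalSpace M]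
    [ChartedSpace (EuclideanSpace ℝ (Fin d)) M] :=
  C^∞⟮(𝓡 d).prod (𝓡 d), M × M; 𝓘(ℝ, 𝕜), 𝕜⟯

/-- `K ∈ C^∞(M × M)` is the kernel of the smoothing operator `S`: `S` and its adjoint are the
integral operators with kernels `K(x, y)` and `conj K(y, x)`, and both map `L²(M)` into
`C^∞(M)`. -/
structure IsSmoothingKernel (g : Metric d M) (K : SmoothKernel 𝕜 d M)
    (S : L2 𝕜 g →L[𝕜] L2 𝕜 g) : Prop where
  self : IsIntegralOperatorIntoSmooth g (fun x y => K (x, y)) S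
  adjoint : IsIntegralOperatorIntoSmooth g (fun x y => conj (K (y, x)))
    (ContinuousLinearMap.adjoint S)

/-- Smoothing operators on `L²(M)`. -/
def IsSmoothing (g : Metric d M) (S : L2 𝕜 g →L[𝕜] L2 𝕜 g) : Prop :=
  ∃ K : SmoothKernel 𝕜 d M, IsSmoothingKernel g K S

/-- Convergence `v n → v∞` in `C^∞(M × M)`, for the topology of the seminorms
`p_{j,k}(v) = sup_{U j} |∇ᵏ v|`, where `U` is an exhaustion of `M × M` by compact sets and `∇` is
the Levi-Civita connection of `g ⊕ g`. -/
def TendstoSmooth (g : Metric d M) (U : CompactExhaustion (M × M)) (v : ℕ → SmoothKernel 𝕜 d M)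
    (vlim : SmoothKernel 𝕜 d M) : Prop :=
  ∀ j k : ℕ, Tendsto
    (fun n => smoothSeminorm ((𝓡 d).prod (𝓡 d)) (prodMetric g) (U j) k (⇑(v n - vlim)))
    atTop (𝓝 0)

end Operators

end NeumannSmoothing

end

/-!
The rows of the kernels of a smoothing operator `A` and of its adjoint are represented by vectors
of `L²(M)` that depend smoothly on the point: they do so weakly by assumption, and a weakly smooth
family of operators is smooth in norm, by the Banach–Steinhaus theorem. For bounded `R` the kernel
of `A R B` at `(x, y)` is `⟨a_x, R b_y⟩`, the value at `R` of a functional that depends smoothly on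
`(x, y)`. Covariant derivatives commute with continuous linear maps, so each `C^∞` seminorm of this
kernel is at most `C ‖R‖`. Since `Sⁿ⁺² = S Sⁿ S`, the series of the kernels of `Sⁿ` converges
because `∑ Sⁿ` converges in operator norm.

The seminorms are computed at each point in the preferred chart of that point. For bounds that are
locally uniform, `∇ᵏ` is transported to a fixed chart, using that the Levi-Civita connection is
natural under isometries.
-/

noncomputable section

set_option maxSynthPendingDepth 3

namespace NeumannSmoothing

section PointwiseSmoothness

variable {𝕜 : Type*} [RCLike 𝕜] {V : Type*} [NormedAddCommGroup V] [NormedSpace 𝕜 V]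
  {W : Type*} [NormedAddCommGroup W] [NormedSpace 𝕜 W] [NormedSpace ℝ W]
  {E : Type*} [NormedAddCommGroup E] [NormedSpace ℝ E]

theorem isBigO_sub_of_pointwise_differentiableAt [CompleteSpace V] {f : E → V →L[𝕜] W} {x : E}
    (hf : ∀ u, DifferentiableAt ℝ (fun z => f z u) x) {s : ℕ → E} (hs : Tendsto s atTop (𝓝 x)) :
    (fun n => f (s n) - f x) =O[atTop] fun n => s n - x := by
  obtain ⟨C, hC⟩ : ∃ C, ∀ n, ‖((‖s n - x‖⁻¹ : ℝ) : 𝕜) • (f (s n) - f x)‖ ≤ C := by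
    refine banach_steinhaus fun u => ?_
    obtain ⟨C, hC0, hC⟩ := Asymptotics.bound_of_isBigO_nat_atTop
      ((hf u).hasFDerivAt.isBigO_sub.comp_tendsto hs)
    refine ⟨C, fun n => ?_⟩
    rcases eq_or_ne (s n - x) 0 with hn | hn
    · simp [hn, hC0.le]
    · simpa [norm_smul, inv_mul_le_iff₀ (norm_pos_iff.2 hn), mul_comm] using hC hn
  refine Asymptotics.IsBigO.of_bound C (Eventually.of_forall fun n => ?_)
  rcases eq_or_ne (s n - x) 0 with hn | hn
  · simp [sub_eq_zero.1 hn]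
  · simpa [norm_smul, inv_mul_le_iff₀ (norm_pos_iff.2 hn), mul_comm] using hC n

theorem continuousAt_of_pointwise_differentiableAt [CompleteSpace V] {f : E → V →L[𝕜] W} {x : E}
    (hf : ∀ u, DifferentiableAt ℝ (fun z => f z u) x) : ContinuousAt f x := by
  rw [ContinuousAt, tendsto_iff_seq_tendsto]
  intro s hs
  have hsub := (isBigO_sub_of_pointwise_differentiableAt hf hs).trans_tendsto
    (tendsto_sub_nhds_zero_iff.2 hs)
  exact tendsto_sub_nhds_zero_iff.1 hsub

variable [IsScalarTower ℝ 𝕜 W]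

/-- Evaluation of `𝕜`-linear operators at a vector, as a real-linear map. -/
def evalCLM (u : V) : (V →L[𝕜] W) →L[ℝ] W :=
  (ContinuousLinearMap.apply 𝕜 W u).restrictScalars ℝ

theorem hasFDerivAt_of_pointwise {f : E → V →L[𝕜] W} {f' : E → E →L[ℝ] V →L[𝕜] W} {x : E}
    (hf : ∀ᶠ z in 𝓝 x, ∀ u, HasFDerivAt (fun z => f z u) (evalCLM u ∘L f' z) z)
    (hf' : ContinuousAt f' x) : HasFDerivAt f (f' x) x := by
  rw [hasFDerivAt_iff_isLittleO, Asymptotics.isLittleO_iff]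
  intro ε hε
  obtain ⟨r, hr, hball⟩ := Metric.mem_nhds_iff.1
    (inter_mem hf (hf' (Metric.closedBall_mem_nhds (f' x) hε)))
  filter_upwards [Metric.ball_mem_nhds x hr] with y hy
  refine ContinuousLinearMap.opNorm_le_bound _ (by positivity) fun u => ?_
  have norm_sub_le : ∀ z ∈ Metric.ball x r,
      ‖evalCLM u ∘L f' z - evalCLM u ∘L f' x‖ ≤ ε * ‖u‖ := fun z hz => by
    rw [← ContinuousLinearMap.comp_sub]
    refine ContinuousLinearMap.opNorm_le_bound _ (by positivity) fun h => ?_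
    calc ‖(f' z - f' x) h u‖ ≤ ‖f' z - f' x‖ * ‖h‖ * ‖u‖ :=
          ((f' z - f' x) h).le_of_opNorm_le ((f' z - f' x).le_opNorm h) u
      _ ≤ ε * ‖h‖ * ‖u‖ := by gcongr; exact mem_closedBall_iff_norm.1 (hball hz).2
      _ = ε * ‖u‖ * ‖h‖ := by ring
  calc ‖f y u - f x u - f' x (y - x) u‖ ≤ ε * ‖u‖ * ‖y - x‖ :=
        (convex_ball x r).norm_image_sub_le_of_norm_hasFDerivWithin_le'
          (fun z hz => ((hball hz).1 u).hasFDerivWithinAt) norm_sub_le (Metric.mem_ball_self hr) hy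
    _ = ε * ‖y - x‖ * ‖u‖ := by ring

variable [CompleteSpace V] [FiniteDimensional ℝ E]

theorem exists_pointwise_fderiv {f : E → V →L[𝕜] W} {x : E}
    (hf : ∀ u, DifferentiableAt ℝ (fun z => f z u) x) :
    ∃ f' : E →L[ℝ] V →L[𝕜] W, ∀ h u, f' h u = fderiv ℝ (fun z => f z u) x h := by
  have exists_directional (h : E) : ∃ L : V →L[𝕜] W, ∀ u, L u = fderiv ℝ (fun z => f z u) x h := by
    have hlim : Tendsto (fun (n : ℕ) (u : V) => (((n : ℝ) : 𝕜) • (f (x + (n : ℝ)⁻¹ • h) - f x)) u)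
        atTop (𝓝 fun u => fderiv ℝ (fun z => f z u) x h) := by
      refine tendsto_pi_nhds.2 fun u => ?_
      simpa [RCLike.real_smul_eq_coe_smul (K := 𝕜)] using (hf u).hasFDerivAt.lim h
        (c := fun n : ℕ => (n : ℝ)) (l := atTop)
        (tendsto_norm_atTop_atTop.comp tendsto_natCast_atTop_atTop)
    exact ⟨continuousLinearMapOfTendsto _ hlim, fun u => rfl⟩
  choose L hL using exists_directional
  let f' : E →ₗ[ℝ] V →L[𝕜] W :=
    { toFun := L
      map_add' := fun a b => by ext u; simp [hL]
      map_smul' := fun a b => by ext u; simp [hL] }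
  exact ⟨LinearMap.toContinuousLinearMap f', fun h u => hL h u⟩

theorem exists_pointwise_fderiv_contDiffOn {f : E → V →L[𝕜] W} {O : Set E} (hO : IsOpen O)
    (hf : ∀ u, ContDiffOn ℝ ∞ (fun z => f z u) O) :
    ∃ f' : E → E →L[ℝ] V →L[𝕜] W,
      (∀ x ∈ O, ∀ u, HasFDerivAt (fun z => f z u) (evalCLM u ∘L f' x) x) ∧
      ∀ h u, ContDiffOn ℝ ∞ (fun z => f' z h u) O := by
  have hdiff : ∀ x ∈ O, ∀ u, DifferentiableAt ℝ (fun z => f z u) x := fun x hx u =>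
    ((hf u).contDiffAt (hO.mem_nhds hx)).differentiableAt (by simp)
  have hex (x : E) : ∃ f' : E →L[ℝ] V →L[𝕜] W,
      x ∈ O → ∀ h u, f' h u = fderiv ℝ (fun z => f z u) x h := by
    by_cases hx : x ∈ O
    · obtain ⟨f', hf'⟩ := exists_pointwise_fderiv (hdiff x hx)
      exact ⟨f', fun _ => hf'⟩
    · exact ⟨0, fun h => absurd h hx⟩
  choose f' hf' using hex
  refine ⟨f', fun x hx u => ?_, fun h u => ?_⟩
  · convert (hdiff x hx u).hasFDerivAt using 1
    ext h
    exact hf' x hx h u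
  · exact (((hf u).fderiv_of_isOpen hO (by simp)).clm_apply contDiffOn_const).congr
      fun z hz => hf' z hz h u

theorem exists_hasFDerivAt_of_pointwise_contDiffOn {f : E → V →L[𝕜] W} {O : Set E}
    (hO : IsOpen O) (hf : ∀ u, ContDiffOn ℝ ∞ (fun z => f z u) O) :
    ∃ f' : E → E →L[ℝ] V →L[𝕜] W, (∀ x ∈ O, HasFDerivAt f (f' x) x) ∧
      ∀ h u, ContDiffOn ℝ ∞ (fun z => f' z h u) O := by
  obtain ⟨f', hderiv, hsmooth⟩ := exists_pointwise_fderiv_contDiffOn hO hf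
  have hcont : ContinuousOn f' O := continuousOn_clm_apply.2 fun h z hz =>
    (continuousAt_of_pointwise_differentiableAt fun u =>
      ((hsmooth h u).contDiffAt (hO.mem_nhds hz)).differentiableAt (by simp)).continuousWithinAt
  exact ⟨f', fun x hx => hasFDerivAt_of_pointwise
    (eventually_of_mem (hO.mem_nhds hx) hderiv) (hcont.continuousAt (hO.mem_nhds hx)), hsmooth⟩

theorem contDiffOn_of_pointwise {f : E → V →L[𝕜] W} {O : Set E} (hO : IsOpen O)
    (hf : ∀ u, ContDiffOn ℝ ∞ (fun z => f z u) O) : ContDiffOn ℝ ∞ f O := by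
  refine contDiffOn_infty.2 fun n => ?_
  induction n generalizing f with
  | zero =>
    obtain ⟨f', hderiv, -⟩ := exists_hasFDerivAt_of_pointwise_contDiffOn hO hf
    exact contDiffOn_zero.2 fun x hx => (hderiv x hx).continuousAt.continuousWithinAt
  | succ n ih =>
    obtain ⟨f', hderiv, hsmooth⟩ := exists_hasFDerivAt_of_pointwise_contDiffOn hO hf
    push_cast
    refine (contDiffOn_succ_iff_fderiv_of_isOpen hO).2
      ⟨fun x hx => (hderiv x hx).differentiableAt.differentiableWithinAt, by simp, ?_⟩
    exact contDiffOn_clm_apply.2 fun h =>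
      (ih (hsmooth h)).congr fun x hx => by rw [(hderiv x hx).fderiv]

variable {H : Type*} [TopologicalSpace H] {I : ModelWithCorners ℝ E H} [I.Boundaryless]
  {N : Type*} [TopologicalSpace N] [ChartedSpace H N] [IsManifold I ∞ N]

theorem contMDiff_of_pointwise {f : N → V →L[𝕜] W}
    (hf : ∀ u, ContMDiff I 𝓘(ℝ, W) ∞ fun p => f p u) : ContMDiff I 𝓘(ℝ, V →L[𝕜] W) ∞ f := by
  intro p
  have hchart : ContDiffOn ℝ ∞ (f ∘ (extChartAt I p).symm) (extChartAt I p).target :=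
    contDiffOn_of_pointwise (isOpen_extChartAt_target p) fun u =>
      ((hf u).comp_contMDiffOn (contMDiffOn_extChartAt_symm p)).contDiffOn
  refine ((hchart.contDiffAt (extChartAt_target_mem_nhds p)).contMDiffAt.comp p
    contMDiffAt_extChartAt).congr_of_eventuallyEq ?_
  filter_upwards [extChartAt_source_mem_nhds (I := I) p] with q hq
  exact congrArg f ((extChartAt I p).left_inv hq).symm

theorem contMDiff_of_inner {V : Type*} [NormedAddCommGroup V] [InnerProductSpace 𝕜 V]
    [NormedSpace ℝ V] [CompleteSpace V] {f : N → V}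
    (hf : ∀ u, ContMDiff I 𝓘(ℝ, 𝕜) ∞ fun p => inner 𝕜 (f p) u) : ContMDiff I 𝓘(ℝ, V) ∞ f := by
  have hdual : ContMDiff I 𝓘(ℝ, V →L[𝕜] 𝕜) ∞ fun p => InnerProductSpace.toDual 𝕜 V (f p) :=
    contMDiff_of_pointwise hf
  -- The real structure on `V` is arbitrary; it coincides with the restricted one because the
  -- additive homeomorphism `toDual⁻¹` is automatically real-linear.
  let riesz : (V →L[𝕜] 𝕜) →L[ℝ] V :=
    AddMonoidHom.toRealLinearMap ((InnerProductSpace.toDual 𝕜 V).symm : (V →L[𝕜] 𝕜) →+ V)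
      (InnerProductSpace.toDual 𝕜 V).symm.continuous
  exact (riesz.contMDiff.comp hdual).congr fun p =>
    ((InnerProductSpace.toDual 𝕜 V).symm_apply_apply (f p)).symm

end PointwiseSmoothness

section CovariantDerivative

variable {F : Type*} [NormedAddCommGroup F] [NormedSpace ℝ F]
  {E : Type*} [NormedAddCommGroup E] [NormedSpace ℝ E] {k : ℕ}

/-- `christoffel` as a continuous bilinear map. -/
def christoffelCLM (G : F → F →L[ℝ] F →L[ℝ] ℝ) (y : F) : F →L[ℝ] F →L[ℝ] F :=
  ContinuousLinearMap.compL ℝ F (F →L[ℝ] ℝ) F (G y).inverse ∘L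
    ((1 / 2 : ℝ) • (fderiv ℝ G y + (fderiv ℝ G y).flip -
      ContinuousLinearMap.flipₗᵢ ℝ F F ℝ ∘L (fderiv ℝ G y).flip))

theorem christoffelCLM_apply (G : F → F →L[ℝ] F →L[ℝ] ℝ) (y u w : F) :
    christoffelCLM G y u w = christoffel G y u w :=
  rfl

/-- The action of endomorphisms of `F` on covariant `k`-tensors by derivations,
`(A, T) ↦ ((w₁, …, w_k) ↦ ∑ᵢ T (w₁, …, A wᵢ, …, w_k))`: the derivative at the identity of the
pull-back action. -/
def derivationAction (F E : Type*) [NormedAddCommGroup F] [NormedSpace ℝ F]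
    [NormedAddCommGroup E] [NormedSpace ℝ E] (k : ℕ) :
    (F →L[ℝ] F) →L[ℝ] (F [×k]→L[ℝ] E) →L[ℝ] F [×k]→L[ℝ] E :=
  (ContinuousMultilinearMap.compContinuousLinearMapContinuousMultilinear ℝ
    (fun _ : Fin k => F) (fun _ => F) E).linearDeriv (fun _ => .id ℝ F) ∘L
    .pi fun _ => .id ℝ (F →L[ℝ] F)

theorem derivationAction_apply (A : F →L[ℝ] F) (T : F [×k]→L[ℝ] E) (w : Fin k → F) :
    derivationAction F E k A T w = ∑ i, T (Function.update w i (A (w i))) := by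
  simp only [derivationAction, ContinuousLinearMap.comp_apply,
    ContinuousMultilinearMap.linearDeriv_apply, sum_apply]
  refine Finset.sum_congr rfl fun i _ => congrArg T (funext fun j => ?_)
  exact Function.apply_update (fun j (L : F →L[ℝ] F) => L (w j)) _ i A j

/-- The covariant derivative of the field `T` of covariant `k`-tensors on `F`, for the Levi-Civita
connection of `G`. The direction of differentiation is the first argument. -/
def covDeriv (G : F → F →L[ℝ] F →L[ℝ] ℝ) (T : F → F [×k]→L[ℝ] E) (y : F) : F [×k + 1]→L[ℝ] E :=
  (fderiv ℝ T y - (derivationAction F E k ∘L christoffelCLM G y).flip (T y)).uncurryLeft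

theorem covDeriv_apply (G : F → F →L[ℝ] F →L[ℝ] ℝ) (T : F → F [×k]→L[ℝ] E) (y : F)
    (w : Fin (k + 1) → F) :
    covDeriv G T y w = fderiv ℝ T y (w 0) (Fin.tail w) -
      ∑ i, T y (Function.update (Fin.tail w) i (christoffel G y (w 0) (Fin.tail w i))) := by
  simp only [covDeriv, ContinuousLinearMap.uncurryLeft_apply, sub_apply,
    ContinuousLinearMap.flip_apply,
    ContinuousLinearMap.comp_apply, derivationAction_apply, christoffelCLM_apply]

/-- The iterated covariant derivative of a function, as a field of bundled multilinear maps. -/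
def iteratedCovTensor (G : F → F →L[ℝ] F →L[ℝ] ℝ) (f : F → E) : (k : ℕ) → F → F [×k]→L[ℝ] E
  | 0 => fun y => ContinuousMultilinearMap.uncurry0 ℝ F (f y)
  | k + 1 => covDeriv G (iteratedCovTensor G f k)

theorem contDiff_bilinearComp {X : Type*} [NormedAddCommGroup X] [NormedSpace ℝ X]
    (A B : X →L[ℝ] F) : ContDiff ℝ ∞ fun b : F →L[ℝ] F →L[ℝ] ℝ => b.bilinearComp A B :=
  (ContinuousLinearMap.flipₗᵢ ℝ X X ℝ).contDiff.comp
    (((ContinuousLinearMap.flipₗᵢ ℝ X F ℝ).contDiff.comp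
      (contDiff_id.clm_comp contDiff_const)).clm_comp contDiff_const)

/-- `G` is a smooth Riemannian metric on the subset `O` of the vector space `F`. -/
structure IsSmoothMetricOn (G : F → F →L[ℝ] F →L[ℝ] ℝ) (O : Set F) : Prop where
  contDiffOn : ContDiffOn ℝ ∞ G O
  symm : ∀ y ∈ O, ∀ u w, G y u w = G y w u
  pos : ∀ y ∈ O, ∀ u, u ≠ 0 → 0 < G y u u

namespace IsSmoothMetricOn

variable {G G' : F → F →L[ℝ] F →L[ℝ] ℝ} {O O' : Set F} {y : F}

theorem mono (hG : IsSmoothMetricOn G O) (h : O' ⊆ O) : IsSmoothMetricOn G O' :=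
  ⟨hG.contDiffOn.mono h, fun y hy => hG.symm y (h hy), fun y hy => hG.pos y (h hy)⟩

theorem congr (hG : IsSmoothMetricOn G O) (h : ∀ y ∈ O, G' y = G y) : IsSmoothMetricOn G' O where
  contDiffOn := hG.contDiffOn.congr h
  symm y hy := by simpa only [h y hy] using hG.symm y hy
  pos y hy := by simpa only [h y hy] using hG.pos y hy

theorem nonneg (hG : IsSmoothMetricOn G O) (hy : y ∈ O) (u : F) : 0 ≤ G y u u := by
  rcases eq_or_ne u 0 with rfl | hu
  · simp
  · exact (hG.pos y hy u hu).le

theorem injective (hG : IsSmoothMetricOn G O) (hy : y ∈ O) : Function.Injective (G y) := by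
  refine (injective_iff_map_eq_zero _).2 fun u hu => ?_
  by_contra hne
  simpa [hu] using hG.pos y hy u hne

theorem differentiableAt (hG : IsSmoothMetricOn G O) (hO : IsOpen O) (hy : y ∈ O) :
    DifferentiableAt ℝ G y :=
  (hG.contDiffOn.contDiffAt (hO.mem_nhds hy)).differentiableAt (by simp)

theorem prod {X : Type*} [NormedAddCommGroup X] [NormedSpace ℝ X] {G₂ : X → X →L[ℝ] X →L[ℝ] ℝ}
    {O₂ : Set X} (hG : IsSmoothMetricOn G O) (hG₂ : IsSmoothMetricOn G₂ O₂) :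
    IsSmoothMetricOn (fun p : F × X =>
      (G p.1).bilinearComp (.fst ℝ F X) (.fst ℝ F X) +
        (G₂ p.2).bilinearComp (.snd ℝ F X) (.snd ℝ F X)) (O ×ˢ O₂) where
  contDiffOn :=
    ((contDiff_bilinearComp _ _).comp_contDiffOn
      (hG.contDiffOn.comp contDiffOn_fst fun _ hp => hp.1)).add
      ((contDiff_bilinearComp _ _).comp_contDiffOn
        (hG₂.contDiffOn.comp contDiffOn_snd fun _ hp => hp.2))
  symm p hp u w := by
    simp [hG.symm p.1 hp.1 u.1, hG₂.symm p.2 hp.2 u.2]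
  pos p hp u hu := by
    change 0 < G p.1 u.1 u.1 + G₂ p.2 u.2 u.2
    rcases eq_or_ne u.1 0 with h₁ | h₁
    · have h₂ : u.2 ≠ 0 := fun h₂ => hu (Prod.ext h₁ h₂)
      exact add_pos_of_nonneg_of_pos (hG.nonneg hp.1 _) (hG₂.pos p.2 hp.2 _ h₂)
    · exact add_pos_of_pos_of_nonneg (hG.pos p.1 hp.1 _ h₁) (hG₂.nonneg hp.2 _)

variable [FiniteDimensional ℝ F]

theorem isInvertible (hG : IsSmoothMetricOn G O) (hy : y ∈ O) : (G y).IsInvertible := by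
  have hdim : Module.finrank ℝ F = Module.finrank ℝ (F →L[ℝ] ℝ) := by
    rw [← (LinearMap.toContinuousLinearMap (𝕜 := ℝ) (E := F) (F' := ℝ)).finrank_eq]
    exact (Subspace.dual_finrank_eq (K := ℝ) (V := F)).symm
  exact ⟨(LinearEquiv.ofInjectiveOfFinrankEq (G y : F →ₗ[ℝ] F →L[ℝ] ℝ) (hG.injective hy)
    hdim).toContinuousLinearEquiv, rfl⟩

theorem two_mul_christoffel (hG : IsSmoothMetricOn G O) (hy : y ∈ O) (u w z : F) :
    2 * G y (christoffel G y u w) z =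
      fderiv ℝ G y u w z + fderiv ℝ G y w u z - fderiv ℝ G y z u w := by
  rw [christoffel, (hG.isInvertible hy).self_apply_inverse]
  simp

set_option synthInstance.maxHeartbeats 100000 in
-- Instance search on iterated spaces of continuous linear maps exceeds the default limit.
theorem contDiffOn_christoffelCLM (hG : IsSmoothMetricOn G O) (hO : IsOpen O) :
    ContDiffOn ℝ ∞ (christoffelCLM G) O := by
  have hinv : ContDiffOn ℝ ∞ (fun y => (G y).inverse) O := fun y hy =>
    (hG.isInvertible hy).contDiffAt_map_inverse.comp_contDiffWithinAt y (hG.contDiffOn y hy)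
  have hD : ContDiffOn ℝ ∞ (fderiv ℝ G) O := hG.contDiffOn.fderiv_of_isOpen hO (by simp)
  have hflip : ContDiffOn ℝ ∞ (fun y => (fderiv ℝ G y).flip) O :=
    (ContinuousLinearMap.flipₗᵢ ℝ F F (F →L[ℝ] ℝ)).contDiff.comp_contDiffOn hD
  have hsum : ContDiffOn ℝ ∞ (fun y => fderiv ℝ G y + (fderiv ℝ G y).flip) O := hD.add hflip
  have hswap : ContDiffOn ℝ ∞ (fun y => (ContinuousLinearMap.flipₗᵢ ℝ F F ℝ ∘L
      (fderiv ℝ G y).flip : F →L[ℝ] F →L[ℝ] F →L[ℝ] ℝ)) O := contDiffOn_const.clm_comp hflip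
  have hkoszul : ContDiffOn ℝ ∞ (fun y => (1 / 2 : ℝ) • (fderiv ℝ G y + (fderiv ℝ G y).flip -
      ContinuousLinearMap.flipₗᵢ ℝ F F ℝ ∘L (fderiv ℝ G y).flip)) O :=
    ContDiffOn.const_smul _ (hsum.sub hswap)
  exact ((ContinuousLinearMap.compL ℝ F (F →L[ℝ] ℝ) F).contDiff.comp_contDiffOn hinv).clm_comp
    hkoszul

theorem contDiffOn_covDeriv (hG : IsSmoothMetricOn G O) (hO : IsOpen O) {T : F → F [×k]→L[ℝ] E}
    (hT : ContDiffOn ℝ ∞ T O) : ContDiffOn ℝ ∞ (covDeriv G T) O := by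
  have hact : ContDiffOn ℝ ∞ (fun y => (derivationAction F E k ∘L christoffelCLM G y).flip) O :=
    (ContinuousLinearMap.flipₗᵢ ℝ F (F [×k]→L[ℝ] E) (F [×k]→L[ℝ] E)).contDiff.comp_contDiffOn
      (contDiffOn_const.clm_comp (hG.contDiffOn_christoffelCLM hO))
  exact (continuousMultilinearCurryLeftEquiv ℝ (fun _ : Fin (k + 1) => F)
    E).symm.contDiff.comp_contDiffOn
      ((hT.fderiv_of_isOpen hO (by simp)).sub (hact.clm_apply hT))

theorem contDiffOn_iteratedCovTensor (hG : IsSmoothMetricOn G O) (hO : IsOpen O) {f : F → E}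
    (hf : ContDiffOn ℝ ∞ f O) (k : ℕ) : ContDiffOn ℝ ∞ (iteratedCovTensor G f k) O := by
  induction k with
  | zero =>
    exact (continuousMultilinearCurryFin0 ℝ F E).symm.contDiff.comp_contDiffOn hf
  | succ k ih => exact hG.contDiffOn_covDeriv hO ih

theorem differentiableAt_iteratedCovTensor (hG : IsSmoothMetricOn G O) (hO : IsOpen O) {f : F → E}
    (hf : ContDiffOn ℝ ∞ f O) (k : ℕ) (hy : y ∈ O) :
    DifferentiableAt ℝ (iteratedCovTensor G f k) y :=
  ((hG.contDiffOn_iteratedCovTensor hO hf k).contDiffAt (hO.mem_nhds hy)).differentiableAt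
    (by simp)

theorem iteratedCovDeriv_eq (hG : IsSmoothMetricOn G O) (hO : IsOpen O) {𝕜 : Type*} [RCLike 𝕜]
    {f : F → 𝕜} (hf : ContDiffOn ℝ ∞ f O) (hy : y ∈ O) (w : Fin k → F) :
    iteratedCovDeriv G f k y w = iteratedCovTensor G f k y w := by
  induction k generalizing y with
  | zero => rfl
  | succ k ih =>
    have heq : (fun z => iteratedCovDeriv G f k z (Fin.tail w)) =ᶠ[𝓝 y]
        fun z => iteratedCovTensor G f k z (Fin.tail w) :=
      eventually_of_mem (hO.mem_nhds hy) fun z hz => ih hz _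
    simp only [iteratedCovDeriv, iteratedCovTensor, covDeriv_apply, ih hy, heq.fderiv_eq,
      fderiv_continuousMultilinear_apply_const_apply
        (hG.differentiableAt_iteratedCovTensor hO hf k hy)]

theorem iteratedCovTensor_clm_comp (hG : IsSmoothMetricOn G O) (hO : IsOpen O)
    {X : Type*} [NormedAddCommGroup X] [NormedSpace ℝ X] {f : F → E} (hf : ContDiffOn ℝ ∞ f O)
    (L : E →L[ℝ] X) (k : ℕ) (hy : y ∈ O) :
    iteratedCovTensor G (L ∘ f) k y =
      L.compContinuousMultilinearMap (iteratedCovTensor G f k y) := by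
  induction k generalizing y with
  | zero => rfl
  | succ k ih =>
    have heq : iteratedCovTensor G (L ∘ f) k =ᶠ[𝓝 y] fun z =>
        ContinuousLinearMap.compContinuousMultilinearMapL ℝ (fun _ : Fin k => F) E X L
          (iteratedCovTensor G f k z) :=
      eventually_of_mem (hO.mem_nhds hy) fun z hz => ih hz
    have hderiv := ((ContinuousLinearMap.compContinuousMultilinearMapL ℝ (fun _ : Fin k => F) E X
      L).hasFDerivAt.comp y
        (hG.differentiableAt_iteratedCovTensor hO hf k hy).hasFDerivAt).congr_of_eventuallyEq heq
    ext w
    simp only [iteratedCovTensor, covDeriv_apply, ih hy, hderiv.fderiv, map_sub, map_sum,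
      ContinuousLinearMap.comp_apply, ContinuousLinearMap.compContinuousMultilinearMapL_apply,
      ContinuousLinearMap.compContinuousMultilinearMap_coe, Function.comp_apply]

end IsSmoothMetricOn

end CovariantDerivative

section ChangeOfCoordinates

variable {F : Type*} [NormedAddCommGroup F] [NormedSpace ℝ F]
  {E : Type*} [NormedAddCommGroup E] [NormedSpace ℝ E]
  {G G' : F → F →L[ℝ] F →L[ℝ] ℝ} {O O' : Set F} {τ : F → F} {y : F}

/-- `τ` is a smooth map from `O'` to `O` which pulls the metric `G` back to the metric `G'`, i.e. a
local isometry from `(O', G')` to `(O, G)`. -/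
structure IsLocalIsometryOn (τ : F → F) (G' : F → F →L[ℝ] F →L[ℝ] ℝ) (O' : Set F)
    (G : F → F →L[ℝ] F →L[ℝ] ℝ) (O : Set F) : Prop where
  contDiffOn : ContDiffOn ℝ ∞ τ O'
  mapsTo : MapsTo τ O' O
  metric_eq : ∀ y ∈ O', ∀ u w, G' y u w = G (τ y) (fderiv ℝ τ y u) (fderiv ℝ τ y w)

namespace IsLocalIsometryOn

theorem hasFDerivAt (hτ : IsLocalIsometryOn τ G' O' G O) (hO' : IsOpen O') (hy : y ∈ O') :
    HasFDerivAt τ (fderiv ℝ τ y) y :=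
  ((hτ.contDiffOn.contDiffAt (hO'.mem_nhds hy)).differentiableAt (by simp)).hasFDerivAt

theorem hasFDerivAt_fderiv (hτ : IsLocalIsometryOn τ G' O' G O) (hO' : IsOpen O') (hy : y ∈ O') :
    HasFDerivAt (fderiv ℝ τ) (fderiv ℝ (fderiv ℝ τ) y) y :=
  (((hτ.contDiffOn.contDiffAt (hO'.mem_nhds hy)).fderiv_right (m := 1)
    (by norm_cast)).differentiableAt (by simp)).hasFDerivAt

theorem fderiv_fderiv_comm (hτ : IsLocalIsometryOn τ G' O' G O) (hO' : IsOpen O') (hy : y ∈ O')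
    (u w : F) : fderiv ℝ (fderiv ℝ τ) y u w = fderiv ℝ (fderiv ℝ τ) y w u :=
  ((hτ.contDiffOn.contDiffAt (hO'.mem_nhds hy)).isSymmSndFDerivAt
    (by rw [minSmoothness_of_isRCLikeNormedField]; norm_cast)).eq u w

theorem fderiv_surjective [FiniteDimensional ℝ F] (hτ : IsLocalIsometryOn τ G' O' G O)
    (hG' : IsSmoothMetricOn G' O') (hy : y ∈ O') : Function.Surjective (fderiv ℝ τ y) := by
  refine LinearMap.injective_iff_surjective (f := (fderiv ℝ τ y : F →ₗ[ℝ] F)).1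
    ((injective_iff_map_eq_zero _).2 fun u (hu : fderiv ℝ τ y u = 0) => ?_)
  by_contra hne
  simpa [hτ.metric_eq y hy, hu] using hG'.pos y hy u hne

theorem fderiv_metric (hτ : IsLocalIsometryOn τ G' O' G O) (hG : IsSmoothMetricOn G O)
    (hO : IsOpen O) (hG' : IsSmoothMetricOn G' O') (hO' : IsOpen O') (hy : y ∈ O') (h a b : F) :
    fderiv ℝ G' y h a b =
      fderiv ℝ G (τ y) (fderiv ℝ τ y h) (fderiv ℝ τ y a) (fderiv ℝ τ y b) +
        G (τ y) (fderiv ℝ (fderiv ℝ τ) y h a) (fderiv ℝ τ y b) +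
        G (τ y) (fderiv ℝ τ y a) (fderiv ℝ (fderiv ℝ τ) y h b) := by
  have hdG' : HasFDerivAt (fun z => G' z a b) _ y :=
    ((hG'.differentiableAt hO' hy).hasFDerivAt.clm_apply (hasFDerivAt_const a y)).clm_apply
      (hasFDerivAt_const b y)
  have hdτ : ∀ c, HasFDerivAt (fun z => fderiv ℝ τ z c) _ y := fun c =>
    (hτ.hasFDerivAt_fderiv hO' hy).clm_apply (hasFDerivAt_const c y)
  have hdG : HasFDerivAt (fun z => G (τ z) (fderiv ℝ τ z a) (fderiv ℝ τ z b)) _ y :=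
    (((hG.differentiableAt hO (hτ.mapsTo hy)).hasFDerivAt.comp y
      (hτ.hasFDerivAt hO' hy)).clm_apply (hdτ a)).clm_apply (hdτ b)
  have heq : (fun z => G' z a b) =ᶠ[𝓝 y] fun z => G (τ z) (fderiv ℝ τ z a) (fderiv ℝ τ z b) :=
    eventually_of_mem (hO'.mem_nhds hy) fun z hz => hτ.metric_eq z hz a b
  have hunique := DFunLike.congr_fun (hdG'.unique (hdG.congr_of_eventuallyEq heq)) h
  simp only [ContinuousLinearMap.comp_zero, zero_add, add_apply, Function.comp_apply,
    ContinuousLinearMap.comp_apply, ContinuousLinearMap.flip_apply] at hunique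
  linarith

theorem fderiv_christoffel [FiniteDimensional ℝ F] (hτ : IsLocalIsometryOn τ G' O' G O)
    (hG : IsSmoothMetricOn G O) (hO : IsOpen O) (hG' : IsSmoothMetricOn G' O') (hO' : IsOpen O')
    (hy : y ∈ O') (u w : F) :
    fderiv ℝ τ y (christoffel G' y u w) =
      christoffel G (τ y) (fderiv ℝ τ y u) (fderiv ℝ τ y w) + fderiv ℝ (fderiv ℝ τ) y u w := by
  have hτy : τ y ∈ O := hτ.mapsTo hy
  refine hG.injective hτy (ContinuousLinearMap.ext fun v => ?_)
  obtain ⟨z, rfl⟩ := hτ.fderiv_surjective hG' hy v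
  have hkoszul' := hG'.two_mul_christoffel hy u w z
  rw [hτ.metric_eq y hy] at hkoszul'
  simp only [hτ.fderiv_metric hG hO hG' hO' hy] at hkoszul'
  rw [hτ.fderiv_fderiv_comm hO' hy z u, hτ.fderiv_fderiv_comm hO' hy z w,
    hτ.fderiv_fderiv_comm hO' hy w u,
    hG.symm _ hτy (fderiv ℝ τ y w) (fderiv ℝ (fderiv ℝ τ) y u z)] at hkoszul'
  have hkoszul := hG.two_mul_christoffel hτy (fderiv ℝ τ y u) (fderiv ℝ τ y w) (fderiv ℝ τ y z)
  rw [map_add, add_apply]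
  linarith

theorem covDeriv_pullback [FiniteDimensional ℝ F] (hτ : IsLocalIsometryOn τ G' O' G O)
    (hG : IsSmoothMetricOn G O) (hO : IsOpen O) (hG' : IsSmoothMetricOn G' O') (hO' : IsOpen O')
    {k : ℕ} {T T' : F → F [×k]→L[ℝ] E} (hy : y ∈ O') (hT : DifferentiableAt ℝ T (τ y))
    (hT' : ∀ z ∈ O', T' z = (T (τ z)).compContinuousLinearMap fun _ => fderiv ℝ τ z) :
    covDeriv G' T' y = (covDeriv G T (τ y)).compContinuousLinearMap fun _ => fderiv ℝ τ y := by
  have hderiv := ((hT.hasFDerivAt.comp y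
    (hτ.hasFDerivAt hO' hy)).continuousMultilinearMapCompContinuousLinearMap fun _ : Fin k =>
      hτ.hasFDerivAt_fderiv hO' hy).congr_of_eventuallyEq
        (eventually_of_mem (hO'.mem_nhds hy) hT')
  have hupdate : ∀ (v : Fin k → F) i u, (fun j => fderiv ℝ τ y (Function.update v i u j)) =
      Function.update (fun j => fderiv ℝ τ y (v j)) i (fderiv ℝ τ y u) := fun v i u =>
    funext fun j => Function.apply_update (fun _ => fderiv ℝ τ y) v i u j
  have hupdate' : ∀ (v : Fin k → F) i (A : F →L[ℝ] F),
      (fun j => Function.update (fun _ => fderiv ℝ τ y) i A j (v j)) =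
        Function.update (fun j => fderiv ℝ τ y (v j)) i (A (v i)) := fun v i A =>
    funext fun j => Function.apply_update (fun j (L : F →L[ℝ] F) => L (v j)) _ i A j
  ext w
  have hderiv_apply : fderiv ℝ T' y (w 0) (Fin.tail w) =
      fderiv ℝ T (τ y) (fderiv ℝ τ y (w 0)) (fun j => fderiv ℝ τ y (Fin.tail w j)) +
        ∑ i, T (τ y) (Function.update (fun j => fderiv ℝ τ y (Fin.tail w j)) i
          (fderiv ℝ (fderiv ℝ τ) y (w 0) (Fin.tail w i))) := by
    simp [hderiv.fderiv, hupdate']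
  simp only [covDeriv_apply, hderiv_apply, hT' y hy,
    ContinuousMultilinearMap.compContinuousLinearMap_apply, hupdate,
    hτ.fderiv_christoffel hG hO hG' hO' hy, ContinuousMultilinearMap.map_update_add,
    Finset.sum_add_distrib, Fin.tail]
  abel

theorem iteratedCovTensor_pullback [FiniteDimensional ℝ F] (hτ : IsLocalIsometryOn τ G' O' G O)
    (hG : IsSmoothMetricOn G O) (hO : IsOpen O) (hG' : IsSmoothMetricOn G' O') (hO' : IsOpen O')
    {f f' : F → E} (hf : ContDiffOn ℝ ∞ f O) (hf' : ∀ z ∈ O', f' z = f (τ z)) (k : ℕ)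
    (hy : y ∈ O') :
    iteratedCovTensor G' f' k y =
      (iteratedCovTensor G f k (τ y)).compContinuousLinearMap fun _ => fderiv ℝ τ y := by
  induction k generalizing y with
  | zero => exact ContinuousMultilinearMap.ext fun _ => hf' y hy
  | succ k ih =>
    exact hτ.covDeriv_pullback hG hO hG' hO' hy
      (hG.differentiableAt_iteratedCovTensor hO hf k (hτ.mapsTo hy)) fun z hz => ih hz

end IsLocalIsometryOn

end ChangeOfCoordinates

section CompactBounds

variable {F : Type*} [NormedAddCommGroup F] [NormedSpace ℝ F]

theorem IsSmoothMetricOn.exists_pos_mul_sq_le [FiniteDimensional ℝ F]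
    {G : F → F →L[ℝ] F →L[ℝ] ℝ} {O s : Set F} (hG : IsSmoothMetricOn G O) (hs : IsCompact s)
    (hsO : s ⊆ O) : ∃ c > 0, ∀ y ∈ s, ∀ u, c * ‖u‖ ^ 2 ≤ G y u u := by
  have hcont : ContinuousOn (fun p : F × F => G p.1 p.2 p.2) (s ×ˢ Metric.sphere (0 : F) 1) :=
    ((hG.contDiffOn.continuousOn.comp continuousOn_fst fun p hp => hsO hp.1).clm_apply
      continuousOn_snd).clm_apply continuousOn_snd
  obtain ⟨c, hc, hle⟩ := (hs.prod (isCompact_sphere (0 : F) 1)).exists_forall_le' hcont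
    (a := 0) fun p hp => hG.pos p.1 (hsO hp.1) p.2 (Metric.ne_of_mem_sphere hp.2 one_ne_zero)
  refine ⟨c, hc, fun y hy u => ?_⟩
  rcases eq_or_ne u 0 with rfl | hu
  · simp
  have hn : ‖u‖ ≠ 0 := norm_ne_zero_iff.2 hu
  have hunit := hle (y, ‖u‖⁻¹ • u) ⟨hy, by simp [norm_smul, hn]⟩
  simp only [map_smul, smul_apply, smul_eq_mul] at hunit
  calc c * ‖u‖ ^ 2 ≤ (‖u‖⁻¹ * (‖u‖⁻¹ * G y u u)) * ‖u‖ ^ 2 := by gcongr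
    _ = G y u u := by field_simp

variable {H : Type*} [TopologicalSpace H] {I : ModelWithCorners ℝ F H}
  {N : Type*} [TopologicalSpace N] [ChartedSpace H N]

/-- A field of bilinear forms on tangent spaces, with the tangent spaces replaced by the model
space that they are copies of. -/
def modelForm (B : ∀ q : N, TangentSpace I q →L[ℝ] TangentSpace I q →L[ℝ] ℝ) (q : N) :
    F →L[ℝ] F →L[ℝ] ℝ :=
  B q

/-- The derivative at `y` of the inverse of the preferred chart at `p`, as a map of the model
space. -/
def chartSymmDeriv (I : ModelWithCorners ℝ F H) (p : N) (y : F) : F →L[ℝ] F :=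
  mfderiv 𝓘(ℝ, F) I (extChartAt I p).symm y

theorem chartMetric_apply (B : ∀ q : N, TangentSpace I q →L[ℝ] TangentSpace I q →L[ℝ] ℝ) (p : N)
    (y u w : F) : chartMetric I B p y u w =
      modelForm B ((extChartAt I p).symm y) (chartSymmDeriv I p y u) (chartSymmDeriv I p y w) :=
  rfl

/-- The domain of the coordinate change from the preferred chart at `p` to the one at `q`. -/
def coordChangeDomain (I : ModelWithCorners ℝ F H) (p q : N) : Set F :=
  (extChartAt I p).target ∩ (extChartAt I p).symm ⁻¹' (extChartAt I q).source

/-- The coordinate change from the preferred chart at `p` to the one at `q`. -/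
def coordChange (I : ModelWithCorners ℝ F H) (p q : N) : F → F :=
  extChartAt I q ∘ (extChartAt I p).symm

theorem extChartAt_symm_coordChange {p q : N} {z : F} (hz : z ∈ coordChangeDomain I p q) :
    (extChartAt I q).symm (coordChange I p q z) = (extChartAt I p).symm z :=
  (extChartAt I q).left_inv hz.2

theorem mapsTo_coordChange (p q : N) :
    MapsTo (coordChange I p q) (coordChangeDomain I p q) (extChartAt I q).target :=
  fun _ hz => (extChartAt I q).map_source hz.2

theorem coordChange_extChartAt (p q : N) :
    coordChange I p q (extChartAt I p p) = extChartAt I q p := by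
  simp only [coordChange, Function.comp_apply, extChartAt_to_inv]

theorem extChartAt_mem_coordChangeDomain {p q : N} (hp : p ∈ (extChartAt I q).source) :
    extChartAt I p p ∈ coordChangeDomain I p q :=
  ⟨mem_extChartAt_target p, by rwa [mem_preimage, extChartAt_to_inv]⟩

theorem isOpen_coordChangeDomain [I.Boundaryless] (p q : N) : IsOpen (coordChangeDomain I p q) :=
  (continuousOn_extChartAt_symm p).isOpen_inter_preimage (isOpen_extChartAt_target p)
    (isOpen_extChartAt_source q)

variable {𝕜 : Type*} [RCLike 𝕜]
  {B : ∀ q : N, TangentSpace I q →L[ℝ] TangentSpace I q →L[ℝ] ℝ}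

theorem covDerivNorm_le {v : N → 𝕜} {k : ℕ} {p : N} {C : ℝ} (hC : 0 ≤ C)
    (h : ∀ w : Fin k → F, (∀ a, chartMetric I B p (extChartAt I p p) (w a) (w a) = 1) →
      ‖iteratedCovDeriv (chartMetric I B p) (v ∘ (extChartAt I p).symm) k (extChartAt I p p) w‖ ≤
        C) :
    covDerivNorm I B v k p ≤ ENNReal.ofReal (√(Module.finrank ℝ F ^ k) * C) := by
  refine iSup_le fun e => ENNReal.ofReal_le_ofReal ?_
  calc √(∑ i : Fin k → Fin (Module.finrank ℝ F), ‖iteratedCovDeriv (chartMetric I B p)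
        (v ∘ (extChartAt I p).symm) k (extChartAt I p p) (fun a => e.1 (i a))‖ ^ 2)
      ≤ √(∑ _i : Fin k → Fin (Module.finrank ℝ F), C ^ 2) := by
        gcongr with i
        exact h _ fun a => by rw [e.2, if_pos rfl]
    _ = √(Module.finrank ℝ F ^ k) * C := by
        simp [Real.sqrt_sq hC]

variable [IsManifold I ∞ N]

theorem contDiffOn_coordChange (p q : N) :
    ContDiffOn ℝ ∞ (coordChange I p q) (coordChangeDomain I p q) :=
  contDiffOn_ext_coord_change q p

theorem contDiffOn_comp_extChartAt_symm {W : Type*} [NormedAddCommGroup W] [NormedSpace ℝ W]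
    {v : N → W} (hv : ContMDiff I 𝓘(ℝ, W) ∞ v) (p : N) :
    ContDiffOn ℝ ∞ (v ∘ (extChartAt I p).symm) (extChartAt I p).target :=
  (hv.comp_contMDiffOn (contMDiffOn_extChartAt_symm p)).contDiffOn

variable [I.Boundaryless]

theorem mdifferentiableAt_extChartAt_symm {p : N} {z : F} (hz : z ∈ (extChartAt I p).target) :
    MDifferentiableAt 𝓘(ℝ, F) I (extChartAt I p).symm z :=
  ((contMDiffOn_extChartAt_symm (n := ∞) p).contMDiffAt
    ((isOpen_extChartAt_target p).mem_nhds hz)).mdifferentiableAt (by simp)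

theorem chartSymmDeriv_comp_fderiv_coordChange {p q : N} {z : F}
    (hz : z ∈ coordChangeDomain I p q) :
    chartSymmDeriv I q (coordChange I p q z) ∘L fderiv ℝ (coordChange I p q) z =
      chartSymmDeriv I p z := by
  have hnhds : coordChangeDomain I p q ∈ 𝓝 z := (isOpen_coordChangeDomain p q).mem_nhds hz
  have hτ : DifferentiableAt ℝ (coordChange I p q) z :=
    ((contDiffOn_coordChange p q).contDiffAt hnhds).differentiableAt (by simp)
  have hchain := mfderiv_comp (I := 𝓘(ℝ, F)) (I' := 𝓘(ℝ, F)) (I'' := I) z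
    (mdifferentiableAt_extChartAt_symm (mapsTo_coordChange p q hz)) hτ.mdifferentiableAt
  have heq : (extChartAt I q).symm ∘ coordChange I p q =ᶠ[𝓝 z] (extChartAt I p).symm :=
    eventually_of_mem hnhds fun x hx => extChartAt_symm_coordChange hx
  rw [heq.mfderiv_eq, mfderiv_eq_fderiv] at hchain
  exact hchain.symm

variable (B) in
theorem isLocalIsometryOn_coordChange (p q : N) :
    IsLocalIsometryOn (coordChange I p q) (chartMetric I B p) (coordChangeDomain I p q)
      (chartMetric I B q) (extChartAt I q).target where
  contDiffOn := contDiffOn_coordChange p q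
  mapsTo := mapsTo_coordChange p q
  metric_eq z hz u w := by
    rw [chartMetric_apply, chartMetric_apply, ← chartSymmDeriv_comp_fderiv_coordChange hz,
      extChartAt_symm_coordChange hz]
    rfl

variable [FiniteDimensional ℝ F]

theorem iteratedCovDeriv_coordChange
    (hB : ∀ p : N, IsSmoothMetricOn (chartMetric I B p) (extChartAt I p).target) {v : N → 𝕜}
    (hv : ContMDiff I 𝓘(ℝ, 𝕜) ∞ v) (k : ℕ) {p q : N} {z : F} (hz : z ∈ coordChangeDomain I p q)
    (w : Fin k → F) :
    iteratedCovDeriv (chartMetric I B p) (v ∘ (extChartAt I p).symm) k z w =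
      iteratedCovTensor (chartMetric I B q) (v ∘ (extChartAt I q).symm) k (coordChange I p q z)
        (fun a => fderiv ℝ (coordChange I p q) z (w a)) := by
  rw [(hB p).iteratedCovDeriv_eq (isOpen_extChartAt_target p)
      (contDiffOn_comp_extChartAt_symm hv p) hz.1,
    (isLocalIsometryOn_coordChange B p q).iteratedCovTensor_pullback (hB q)
      (isOpen_extChartAt_target q) ((hB p).mono inter_subset_left) (isOpen_coordChangeDomain p q)
      (contDiffOn_comp_extChartAt_symm hv q)
      (f' := v ∘ (extChartAt I p).symm)
      (fun z hz => (congrArg v (extChartAt_symm_coordChange hz)).symm) k hz]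
  rfl

variable {W : Type*} [NormedAddCommGroup W] [NormedSpace ℝ W]

theorem exists_nhds_norm_iteratedCovDeriv_le
    (hB : ∀ p : N, IsSmoothMetricOn (chartMetric I B p) (extChartAt I p).target)
    {Φ : N → W} (hΦ : ContMDiff I 𝓘(ℝ, W) ∞ Φ) (k : ℕ) (q : N) :
    ∃ t ∈ 𝓝 q, ∃ C, 0 ≤ C ∧ ∀ (L : W →L[ℝ] 𝕜), ∀ p ∈ t, ∀ w : Fin k → F,
      (∀ a, chartMetric I B p (extChartAt I p p) (w a) (w a) = 1) →
      ‖iteratedCovDeriv (chartMetric I B p) ((L ∘ Φ) ∘ (extChartAt I p).symm) k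
        (extChartAt I p p) w‖ ≤ C * ‖L‖ := by
  have hO := isOpen_extChartAt_target (I := I) q
  have hΦq := contDiffOn_comp_extChartAt_symm hΦ q
  obtain ⟨r, hr, hrO⟩ := Metric.nhds_basis_closedBall.mem_iff.1
    (hO.mem_nhds (mem_extChartAt_target (I := I) q))
  have hcompact : IsCompact (Metric.closedBall (extChartAt I q q) r) := isCompact_closedBall _ _
  obtain ⟨c, hc, hcle⟩ := (hB q).exists_pos_mul_sq_le hcompact hrO
  obtain ⟨C, hC⟩ := hcompact.exists_bound_of_continuousOn
    (((hB q).contDiffOn_iteratedCovTensor hO hΦq k).continuousOn.mono hrO)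
  have hC0 : 0 ≤ C := (norm_nonneg _).trans (hC _ (Metric.mem_closedBall_self hr.le))
  refine ⟨(extChartAt I q).source ∩ extChartAt I q ⁻¹' Metric.closedBall (extChartAt I q q) r,
    inter_mem (extChartAt_source_mem_nhds q)
      ((continuousAt_extChartAt q).preimage_mem_nhds (Metric.closedBall_mem_nhds _ hr)),
    C * √c⁻¹ ^ k, by positivity, ?_⟩
  rintro L p ⟨hpq, hpr⟩ w hw
  have hp := extChartAt_mem_coordChangeDomain hpq
  rw [mem_preimage, ← coordChange_extChartAt p q] at hpr
  have hwle : ∀ a, ‖fderiv ℝ (coordChange I p q) (extChartAt I p p) (w a)‖ ≤ √c⁻¹ := fun a => by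
    have hle := hcle _ hpr (fderiv ℝ (coordChange I p q) (extChartAt I p p) (w a))
    rw [← (isLocalIsometryOn_coordChange B p q).metric_eq _ hp, hw a] at hle
    refine Real.le_sqrt_of_sq_le ?_
    rwa [← one_div, le_div_iff₀' hc]
  rw [iteratedCovDeriv_coordChange hB (L.contDiff.comp_contMDiff hΦ) k hp, Function.comp_assoc,
    (hB q).iteratedCovTensor_clm_comp hO hΦq L k (hrO hpr), mul_comm]
  refine (L.le_opNorm _).trans (mul_le_mul_of_nonneg_left ?_ (norm_nonneg L))
  refine (ContinuousMultilinearMap.le_mul_prod_of_opNorm_le_of_le (hC _ hpr) hwle).trans_eq ?_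
  simp

theorem exists_nhds_covDerivNorm_le
    (hB : ∀ p : N, IsSmoothMetricOn (chartMetric I B p) (extChartAt I p).target)
    {Φ : N → W} (hΦ : ContMDiff I 𝓘(ℝ, W) ∞ Φ) (k : ℕ) (q : N) :
    ∃ t ∈ 𝓝 q, ∃ C, 0 ≤ C ∧ ∀ (L : W →L[ℝ] 𝕜), ∀ p ∈ t,
      covDerivNorm I B (L ∘ Φ) k p ≤ ENNReal.ofReal (C * ‖L‖) := by
  obtain ⟨t, ht, C, hC, h⟩ := exists_nhds_norm_iteratedCovDeriv_le (𝕜 := 𝕜) hB hΦ k q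
  refine ⟨t, ht, √(Module.finrank ℝ F ^ k) * C, by positivity, fun L p hp => ?_⟩
  rw [mul_assoc]
  exact covDerivNorm_le (by positivity) (h L p hp)

theorem exists_smoothSeminorm_le
    (hB : ∀ p : N, IsSmoothMetricOn (chartMetric I B p) (extChartAt I p).target)
    {Φ : N → W} (hΦ : ContMDiff I 𝓘(ℝ, W) ∞ Φ) (k : ℕ) {U : Set N} (hU : IsCompact U) :
    ∃ C, 0 ≤ C ∧ ∀ L : W →L[ℝ] 𝕜,
      smoothSeminorm I B U k (L ∘ Φ) ≤ ENNReal.ofReal (C * ‖L‖) := by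
  suffices ∃ C, 0 ≤ C ∧ ∀ L : W →L[ℝ] 𝕜, ∀ p ∈ U,
      covDerivNorm I B (L ∘ Φ) k p ≤ ENNReal.ofReal (C * ‖L‖) from
    this.imp fun C h => ⟨h.1, fun L => iSup₂_le (h.2 L)⟩
  refine hU.induction_on (p := fun U => ∃ C, 0 ≤ C ∧ ∀ L : W →L[ℝ] 𝕜, ∀ p ∈ U,
      covDerivNorm I B (L ∘ Φ) k p ≤ ENNReal.ofReal (C * ‖L‖)) ⟨0, le_rfl, by simp⟩ ?_ ?_ ?_
  · rintro s t hst ⟨C, hC, h⟩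
    exact ⟨C, hC, fun L p hp => h L p (hst hp)⟩
  · rintro s t ⟨C, hC, h⟩ ⟨C', -, h'⟩
    refine ⟨max C C', le_max_of_le_left hC, ?_⟩
    rintro L p (hp | hp)
    · exact (h L p hp).trans (ENNReal.ofReal_le_ofReal (by gcongr; exact le_max_left _ _))
    · exact (h' L p hp).trans (ENNReal.ofReal_le_ofReal (by gcongr; exact le_max_right _ _))
  · intro q _
    obtain ⟨t, ht, h⟩ := exists_nhds_covDerivNorm_le (𝕜 := 𝕜) hB hΦ k q
    exact ⟨t, mem_nhdsWithin_of_mem_nhds ht, h⟩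

end CompactBounds

section MetricInCoordinates

variable {F : Type*} [NormedAddCommGroup F] [NormedSpace ℝ F] {H : Type*} [TopologicalSpace H]
  {I : ModelWithCorners ℝ F H} [I.Boundaryless]
  {N : Type*} [TopologicalSpace N] [ChartedSpace H N] [IsManifold I ∞ N]

theorem chartSymmDeriv_injective (p : N) {y : F} (hy : y ∈ (extChartAt I p).target) :
    Function.Injective (chartSymmDeriv I p y) := by
  have hinv := isInvertible_mfderivWithin_extChartAt_symm (I := I) (x := p) hy
  rw [I.range_eq_univ, mfderivWithin_univ] at hinv
  exact hinv.injective

theorem contMDiffOn_chartSymmDeriv (p : N) (u : F) :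
    ContMDiffOn 𝓘(ℝ, F) I.tangent ∞
      (fun y => (⟨(extChartAt I p).symm y, chartSymmDeriv I p y u⟩ : TangentBundle I N))
      (extChartAt I p).target := by
  have hO := isOpen_extChartAt_target (I := I) p
  have htangent := (contMDiffOn_extChartAt_symm (I := I) (n := ∞) p).contMDiffOn_tangentMapWithin
    (m := ∞) (by simp) hO.uniqueMDiffOn
  have hconst : ContMDiff 𝓘(ℝ, F) 𝓘(ℝ, F).tangent ∞
      (fun y : F => (⟨y, u⟩ : TangentBundle 𝓘(ℝ, F) F)) :=
    contMDiff_vectorSpace_iff_contDiff.2 contDiff_const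
  refine (htangent.comp hconst.contMDiffOn fun y hy => hy).congr fun y hy => ?_
  simp only [Function.comp_apply, tangentMapWithin, mfderivWithin_of_isOpen hO hy]
  rfl

theorem contDiffOn_chartMetric [FiniteDimensional ℝ F]
    {B : ∀ q : N, TangentSpace I q →L[ℝ] TangentSpace I q →L[ℝ] ℝ}
    (hB : ContMDiff I (I.prod 𝓘(ℝ, F →L[ℝ] F →L[ℝ] ℝ)) ∞
      fun q => TotalSpace.mk' (F →L[ℝ] F →L[ℝ] ℝ)
        (E := fun q : N => TangentSpace I q →L[ℝ] TangentSpace I q →L[ℝ] ℝ) q (B q)) (p : N) :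
    ContDiffOn ℝ ∞ (chartMetric I B p) (extChartAt I p).target := by
  refine contDiffOn_clm_apply.2 fun u => contDiffOn_clm_apply.2 fun w y hy => ?_
  have hBuw : ContMDiffWithinAt 𝓘(ℝ, F) (I.prod 𝓘(ℝ)) ∞
      (fun y => TotalSpace.mk' ℝ (E := Bundle.Trivial N ℝ) ((extChartAt I p).symm y)
        (B ((extChartAt I p).symm y) (chartSymmDeriv I p y u) (chartSymmDeriv I p y w)))
      (extChartAt I p).target y :=
    ContMDiffWithinAt.clm_bundle_apply₂ (F₁ := F) (F₂ := F)
      ((hB.comp_contMDiffOn (contMDiffOn_extChartAt_symm p)) y hy)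
      (contMDiffOn_chartSymmDeriv p u y hy) (contMDiffOn_chartSymmDeriv p w y hy)
  rw [contMDiffWithinAt_totalSpace] at hBuw
  exact hBuw.2.contDiffWithinAt

theorem chartSymmDeriv_prod {F' : Type*} [NormedAddCommGroup F'] [NormedSpace ℝ F']
    {H' : Type*} [TopologicalSpace H'] {J : ModelWithCorners ℝ F' H'} [J.Boundaryless]
    {N' : Type*} [TopologicalSpace N'] [ChartedSpace H' N'] [IsManifold J ∞ N'] (p : N × N')
    {y : F × F'} (hy : y ∈ (extChartAt I p.1).target ×ˢ (extChartAt J p.2).target) :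
    chartSymmDeriv (I.prod J) p y =
      (chartSymmDeriv I p.1 y.1).prodMap (chartSymmDeriv J p.2 y.2) := by
  have hd₁ := mdifferentiableAt_extChartAt_symm hy.1
  have hd₂ := mdifferentiableAt_extChartAt_symm hy.2
  have hfst : MDifferentiableAt 𝓘(ℝ, F × F') 𝓘(ℝ, F) Prod.fst y :=
    differentiableAt_fst.mdifferentiableAt
  have hsnd : MDifferentiableAt 𝓘(ℝ, F × F') 𝓘(ℝ, F') Prod.snd y :=
    differentiableAt_snd.mdifferentiableAt
  have hprod := MDifferentiableAt.mfderiv_prod (hd₁.comp y hfst) (hd₂.comp y hsnd)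
  rw [mfderiv_comp y hd₁ hfst, mfderiv_comp y hd₂ hsnd, mfderiv_eq_fderiv, mfderiv_eq_fderiv,
    fderiv_fst, fderiv_snd] at hprod
  have hsymm : (extChartAt (I.prod J) p).symm =
      fun z => (((extChartAt I p.1).symm ∘ Prod.fst) z,
        ((extChartAt J p.2).symm ∘ Prod.snd) z) := by
    rw [extChartAt_prod]
    rfl
  rw [chartSymmDeriv, hsymm]
  exact hprod

variable {d : ℕ} {M : Type*} [TopologicalSpace M] [ChartedSpace (EuclideanSpace ℝ (Fin d)) M]
  [IsManifold (𝓡 d) ∞ M]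

theorem isSmoothMetricOn_chartMetric (g : Metric d M) (x : M) :
    IsSmoothMetricOn (chartMetric (𝓡 d) g.inner x) (extChartAt (𝓡 d) x).target where
  contDiffOn := contDiffOn_chartMetric g.contMDiff x
  symm y _ u w := g.symm ((extChartAt (𝓡 d) x).symm y) (chartSymmDeriv (𝓡 d) x y u)
    (chartSymmDeriv (𝓡 d) x y w)
  pos y hy u hu := by
    have hne : chartSymmDeriv (𝓡 d) x y u ≠ 0 := fun h0 =>
      hu (chartSymmDeriv_injective x hy (h0.trans (map_zero _).symm))
    exact g.pos ((extChartAt (𝓡 d) x).symm y) (chartSymmDeriv (𝓡 d) x y u) hne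

theorem chartMetric_prodMetric (g : Metric d M) (p : M × M)
    {y : EuclideanSpace ℝ (Fin d) × EuclideanSpace ℝ (Fin d)}
    (hy : y ∈ (extChartAt (𝓡 d) p.1).target ×ˢ (extChartAt (𝓡 d) p.2).target) :
    chartMetric ((𝓡 d).prod (𝓡 d)) (prodMetric g) p y =
      (chartMetric (𝓡 d) g.inner p.1 y.1).bilinearComp (.fst ℝ _ _) (.fst ℝ _ _) +
        (chartMetric (𝓡 d) g.inner p.2 y.2).bilinearComp (.snd ℝ _ _) (.snd ℝ _ _) := by
  refine ContinuousLinearMap.ext fun u => ContinuousLinearMap.ext fun w => ?_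
  rw [chartMetric_apply, chartSymmDeriv_prod p hy, extChartAt_prod]
  rfl

theorem isSmoothMetricOn_chartMetric_prodMetric (g : Metric d M) (p : M × M) :
    IsSmoothMetricOn (chartMetric ((𝓡 d).prod (𝓡 d)) (prodMetric g) p)
      (extChartAt ((𝓡 d).prod (𝓡 d)) p).target := by
  rw [extChartAt_prod, PartialEquiv.prod_target]
  exact ((isSmoothMetricOn_chartMetric g p.1).prod (isSmoothMetricOn_chartMetric g p.2)).congr
    fun y hy => chartMetric_prodMetric g p hy

theorem IsSmoothMetricOn.det_gram_pos
    {G : EuclideanSpace ℝ (Fin d) → EuclideanSpace ℝ (Fin d) →L[ℝ] EuclideanSpace ℝ (Fin d) →L[ℝ] ℝ}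
    {O : Set (EuclideanSpace ℝ (Fin d))} (hG : IsSmoothMetricOn G O) {y : EuclideanSpace ℝ (Fin d)}
    (hy : y ∈ O) :
    0 < (Matrix.of fun i j : Fin d =>
      G y (EuclideanSpace.single i 1) (EuclideanSpace.single j 1)).det := by
  refine Matrix.PosDef.det_pos (Matrix.PosDef.of_dotProduct_mulVec_pos ?_ fun v hv => ?_)
  · ext i j
    simp [hG.symm y hy (EuclideanSpace.single i 1)]
  · have hbasis : (WithLp.toLp 2 v : EuclideanSpace ℝ (Fin d)) =
        ∑ i, v i • EuclideanSpace.single i (1 : ℝ) := by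
      ext j
      simp [Finset.sum_apply, Pi.single_apply]
    have hpos := hG.pos y hy (WithLp.toLp 2 v) (by simpa using hv)
    simp only [hbasis, map_sum, map_smul, sum_apply, smul_apply, smul_eq_mul,
      Finset.mul_sum] at hpos
    simp only [dotProduct, Matrix.mulVec, star_trivial, Matrix.of_apply, Finset.mul_sum]
    rw [Finset.sum_comm]
    exact hpos.trans_eq (Finset.sum_congr rfl fun i _ => Finset.sum_congr rfl fun j _ => by ring)

theorem IsSmoothMetricOn.continuousOn_det_gram
    {G : EuclideanSpace ℝ (Fin d) → EuclideanSpace ℝ (Fin d) →L[ℝ] EuclideanSpace ℝ (Fin d) →L[ℝ] ℝ}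
    {O : Set (EuclideanSpace ℝ (Fin d))} (hG : IsSmoothMetricOn G O) :
    ContinuousOn (fun y => (Matrix.of fun i j : Fin d =>
      G y (EuclideanSpace.single i 1) (EuclideanSpace.single j 1)).det) O :=
  continuousOn_iff_continuous_domRestrict.2 <| Continuous.matrix_det <|
    continuous_pi fun _ => continuous_pi fun _ => continuousOn_iff_continuous_domRestrict.1 <|
      (hG.contDiffOn.continuousOn.clm_apply continuousOn_const).clm_apply continuousOn_const

variable [MeasurableSpace M] [BorelSpace M]

theorem chartVolume_ne_zero (g : Metric d M) {x : M} {U : Set M} (hU : IsOpen U) (hx : x ∈ U) :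
    chartVolume g x U ≠ 0 := by
  have hO := isOpen_extChartAt_target (I := 𝓡 d) x
  have hG := isSmoothMetricOn_chartMetric g x
  have hsymm : AEMeasurable (extChartAt (𝓡 d) x).symm
      (volume.restrict (extChartAt (𝓡 d) x).target) :=
    (continuousOn_extChartAt_symm x).aemeasurable hO.measurableSet
  have hdensity := (ENNReal.continuous_ofReal.comp_continuousOn
    hG.continuousOn_det_gram.sqrt).aemeasurable (μ := volume) hO.measurableSet
  rw [chartVolume, Measure.map_apply_of_aemeasurable
    (hsymm.mono_ac (withDensity_absolutelyContinuous _ _)) hU.measurableSet]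
  intro hnull
  have hac := withDensity_absolutelyContinuous' hdensity <|
    (ae_restrict_mem hO.measurableSet).mono fun y hy => by
      simpa using hG.det_gram_pos hy
  have hnull' := hac hnull
  have hV : IsOpen ((extChartAt (𝓡 d) x).symm ⁻¹' U ∩ (extChartAt (𝓡 d) x).target) := by
    rw [inter_comm]
    exact (continuousOn_extChartAt_symm x).isOpen_inter_preimage hO hU
  refine (hV.measure_pos volume ⟨extChartAt (𝓡 d) x x, ?_, mem_extChartAt_target x⟩).ne' ?_
  · rwa [mem_preimage, extChartAt_to_inv]
  · rwa [Measure.restrict_apply' hO.measurableSet] at hnull'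

theorem isOpenPosMeasure_riemannianVolume (g : Metric d M) :
    (riemannianVolume g).IsOpenPosMeasure where
  open_pos U hU := fun ⟨x, hx⟩ hnull => chartVolume_ne_zero g hU hx <|
    le_antisymm ((le_iSup (chartVolume g) x U).trans hnull.le) zero_le

end MetricInCoordinates

section Kernels

variable {d : ℕ} {M : Type*} [TopologicalSpace M] [ChartedSpace (EuclideanSpace ℝ (Fin d)) M]
  [IsManifold (𝓡 d) ∞ M] [MeasurableSpace M] {𝕜 : Type*} [RCLike 𝕜] {g : Metric d M}

/-- The vector `conj k(x, ·)` of `L²(M)`, which represents the functional `u ↦ ∫ k(x, y) u(y) dy`.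
The conjugate appears because inner products are conjugate linear in the first argument. -/
def rowVec {k : M → M → 𝕜} (hk : ∀ x, MemLp (k x) 2 (riemannianVolume g)) (x : M) : L2 𝕜 g :=
  (hk x).star.toLp

theorem inner_rowVec {k : M → M → 𝕜} (hk : ∀ x, MemLp (k x) 2 (riemannianVolume g)) (x : M)
    (u : L2 𝕜 g) : inner 𝕜 (rowVec hk x) u = ∫ y, k x y * u y ∂riemannianVolume g := by
  rw [L2.inner_def]
  refine integral_congr_ae ?_
  filter_upwards [(hk x).star.coeFn_toLp] with y hy
  rw [rowVec, hy, RCLike.inner_apply, Pi.star_apply, RCLike.star_def, RCLike.conj_conj, mul_comm]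

variable {k k' : M → M → 𝕜} {A B : L2 𝕜 g →L[𝕜] L2 𝕜 g}

namespace IsIntegralOperatorIntoSmooth

theorem ae_eq_inner (h : IsIntegralOperatorIntoSmooth g k A) (u : L2 𝕜 g) :
    A u =ᵐ[riemannianVolume g] fun x => inner 𝕜 (rowVec h.memLp x) u := by
  simpa only [inner_rowVec] using h.ae_eq u

theorem contMDiff_rowVec (h : IsIntegralOperatorIntoSmooth g k A) :
    ContMDiff (𝓡 d) 𝓘(ℝ, L2 𝕜 g) ∞ (rowVec h.memLp) :=
  contMDiff_of_inner (𝕜 := 𝕜) fun u => by simpa only [inner_rowVec] using h.contMDiff u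

theorem rowVec_unique [BorelSpace M] (h : IsIntegralOperatorIntoSmooth g k A)
    (h' : IsIntegralOperatorIntoSmooth g k' A) : rowVec h.memLp = rowVec h'.memLp := by
  have := isOpenPosMeasure_riemannianVolume g
  refine funext fun x => ext_inner_right 𝕜 fun u => ?_
  simp only [inner_rowVec]
  exact congrFun (((h.contMDiff u).continuous.ae_eq_iff_eq (riemannianVolume g)
    (h'.contMDiff u).continuous).1 ((h.ae_eq u).symm.trans (h'.ae_eq u))) x

theorem add (h : IsIntegralOperatorIntoSmooth g k A) (h' : IsIntegralOperatorIntoSmooth g k' B) :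
    IsIntegralOperatorIntoSmooth g (fun x y => k x y + k' x y) (A + B) := by
  have integral_add_mul (u : L2 𝕜 g) (x : M) :
      ∫ y, (k x y + k' x y) * u y ∂riemannianVolume g =
        (∫ y, k x y * u y ∂riemannianVolume g) + ∫ y, k' x y * u y ∂riemannianVolume g := by
    simp only [add_mul]
    exact integral_add ((h.memLp x).integrable_mul (Lp.memLp u))
      ((h'.memLp x).integrable_mul (Lp.memLp u))
  refine ⟨fun x => (h.memLp x).add (h'.memLp x), fun u => ?_, fun u => ?_⟩
  · simp only [integral_add_mul]
    exact (Lp.coeFn_add (A u) (B u)).trans ((h.ae_eq u).add (h'.ae_eq u))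
  · simp only [integral_add_mul]
    exact (h.contMDiff u).add (h'.contMDiff u)

theorem mul_mul (h : IsIntegralOperatorIntoSmooth g k A)
    (h' : IsIntegralOperatorIntoSmooth g k' (ContinuousLinearMap.adjoint B))
    (R : L2 𝕜 g →L[𝕜] L2 𝕜 g) :
    IsIntegralOperatorIntoSmooth g
      (fun x y => inner 𝕜 (rowVec h.memLp x) (R (rowVec h'.memLp y))) (A * R * B) := by
  have row_ae_eq (x : M) : (fun y => inner 𝕜 (rowVec h.memLp x) (R (rowVec h'.memLp y)))
      =ᵐ[riemannianVolume g] star ⇑(ContinuousLinearMap.adjoint B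
        (ContinuousLinearMap.adjoint R (rowVec h.memLp x))) := by
    filter_upwards [h'.ae_eq_inner (ContinuousLinearMap.adjoint R (rowVec h.memLp x))] with y hy
    rw [Pi.star_apply, hy, RCLike.star_def, inner_conj_symm, ContinuousLinearMap.adjoint_inner_left]
  have integral_row_mul (u : L2 𝕜 g) (x : M) :
      ∫ y, inner 𝕜 (rowVec h.memLp x) (R (rowVec h'.memLp y)) * u y ∂riemannianVolume g =
        ∫ y, k x y * (R (B u)) y ∂riemannianVolume g := by
    rw [← inner_rowVec h.memLp, ← ContinuousLinearMap.adjoint_inner_left,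
      ← ContinuousLinearMap.adjoint_inner_left, L2.inner_def]
    refine integral_congr_ae ?_
    filter_upwards [row_ae_eq x] with y hy
    rw [hy, RCLike.inner_apply, Pi.star_apply, RCLike.star_def, mul_comm]
  refine ⟨fun x => (memLp_congr_ae (row_ae_eq x)).2 (Lp.memLp _).star, fun u => ?_, fun u => ?_⟩
  · simp only [integral_row_mul]
    exact h.ae_eq (R (B u))
  · simp only [integral_row_mul]
    exact h.contMDiff (R (B u))

end IsIntegralOperatorIntoSmooth

variable {K L : SmoothKernel 𝕜 d M}

theorem IsSmoothingKernel.unique [BorelSpace M] (hK : IsSmoothingKernel g K A)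
    (hL : IsSmoothingKernel g L A) : K = L := by
  have := isOpenPosMeasure_riemannianVolume g
  ext ⟨x, y⟩
  have hrow : (fun y => star (K (x, y))) =ᵐ[riemannianVolume g] fun y => star (L (x, y)) :=
    (MemLp.toLp_eq_toLp_iff _ _).1 (congrFun (hK.self.rowVec_unique hL.self) x)
  have hcont (J : SmoothKernel 𝕜 d M) : Continuous fun y => star (J (x, y)) :=
    (J.contMDiff.continuous.comp (Continuous.prodMk_right x)).star
  exact star_injective <|
    congrFun (((hcont K).ae_eq_iff_eq (riemannianVolume g) (hcont L)).1 hrow) y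

theorem IsSmoothingKernel.add (hA : IsSmoothingKernel g K A) (hB : IsSmoothingKernel g L B) :
    IsSmoothingKernel g (K + L) (A + B) where
  self := hA.self.add hB.self
  adjoint := by
    simpa only [map_add, ContMDiffMap.coe_add, Pi.add_apply] using hA.adjoint.add hB.adjoint

/-- The kernel of `A R B` at a point `p = (x, y)`, for smoothing operators `A` and `B`, as a
functional `R ↦ ⟨a_x, R b_y⟩` of the bounded operator `R`. Here `a_x` and `b_y` represent the rows
of the kernels of `A` and of the adjoint of `B`. -/
def sandwichFunctional (hA : IsSmoothingKernel g K A) (hB : IsSmoothingKernel g L B) (p : M × M) :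
    (L2 𝕜 g →L[𝕜] L2 𝕜 g) →L[𝕜] 𝕜 :=
  innerSL 𝕜 (rowVec hA.self.memLp p.1) ∘L
    ContinuousLinearMap.apply 𝕜 (L2 𝕜 g) (rowVec hB.adjoint.memLp p.2)

theorem contMDiff_sandwichFunctional_apply (hA : IsSmoothingKernel g K A)
    (hB : IsSmoothingKernel g L B) (R : L2 𝕜 g →L[𝕜] L2 𝕜 g) :
    ContMDiff ((𝓡 d).prod (𝓡 d)) 𝓘(ℝ, 𝕜) ∞ fun p => sandwichFunctional hA hB p R := by
  have hrows : ContMDiff ((𝓡 d).prod (𝓡 d)) 𝓘(ℝ, L2 𝕜 g × L2 𝕜 g) ∞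
      fun p : M × M => (rowVec hA.self.memLp p.1, rowVec hB.adjoint.memLp p.2) :=
    (hA.self.contMDiff_rowVec.comp contMDiff_fst).prodMk_space
      (hB.adjoint.contMDiff_rowVec.comp contMDiff_snd)
  have hinner : ContDiff ℝ ∞ fun q : L2 𝕜 g × L2 𝕜 g => inner 𝕜 q.1 (R q.2) :=
    contDiff_fst.inner 𝕜 ((R.restrictScalars ℝ).contDiff.comp contDiff_snd)
  exact hinner.contMDiff.comp hrows

theorem contMDiff_sandwichFunctional (hA : IsSmoothingKernel g K A)
    (hB : IsSmoothingKernel g L B) :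
    ContMDiff ((𝓡 d).prod (𝓡 d)) 𝓘(ℝ, (L2 𝕜 g →L[𝕜] L2 𝕜 g) →L[𝕜] 𝕜) ∞
      (sandwichFunctional hA hB) :=
  contMDiff_of_pointwise (contMDiff_sandwichFunctional_apply hA hB)

/-- The kernel of `A R B`, for smoothing operators `A` and `B`, as an additive function of the
bounded operator `R`. -/
def sandwichKernel (hA : IsSmoothingKernel g K A) (hB : IsSmoothingKernel g L B) :
    (L2 𝕜 g →L[𝕜] L2 𝕜 g) →+ SmoothKernel 𝕜 d M where
  toFun R :=
    ⟨fun p => sandwichFunctional hA hB p R, contMDiff_sandwichFunctional_apply hA hB R⟩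
  map_zero' := ContMDiffMap.ext fun p => map_zero (sandwichFunctional hA hB p)
  map_add' R T := ContMDiffMap.ext fun p => map_add (sandwichFunctional hA hB p) R T

theorem sandwichKernel_apply (hA : IsSmoothingKernel g K A) (hB : IsSmoothingKernel g L B)
    (R : L2 𝕜 g →L[𝕜] L2 𝕜 g) (p : M × M) : sandwichKernel hA hB R p =
      inner 𝕜 (rowVec hA.self.memLp p.1) (R (rowVec hB.adjoint.memLp p.2)) :=
  rfl

theorem isSmoothingKernel_sandwichKernel (hA : IsSmoothingKernel g K A)
    (hB : IsSmoothingKernel g L B) (R : L2 𝕜 g →L[𝕜] L2 𝕜 g) :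
    IsSmoothingKernel g (sandwichKernel hA hB R) (A * R * B) where
  self := hA.self.mul_mul hB.adjoint R
  adjoint := by
    have hA' : IsIntegralOperatorIntoSmooth g (fun x y => K (x, y))
        (ContinuousLinearMap.adjoint (ContinuousLinearMap.adjoint A)) := by
      rw [ContinuousLinearMap.adjoint_adjoint]
      exact hA.self
    have hadj : ContinuousLinearMap.adjoint (A * R * B) = ContinuousLinearMap.adjoint B *
        ContinuousLinearMap.adjoint R * ContinuousLinearMap.adjoint A := by
      simp only [← ContinuousLinearMap.star_eq_adjoint, star_mul, mul_assoc]
    simpa only [hadj, sandwichKernel_apply, inner_conj_symm,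
      ContinuousLinearMap.adjoint_inner_right] using
      hB.adjoint.mul_mul hA' (ContinuousLinearMap.adjoint R)

theorem exists_smoothSeminorm_sandwichKernel_le (hA : IsSmoothingKernel g K A)
    (hB : IsSmoothingKernel g L B) (k : ℕ) {U : Set (M × M)} (hU : IsCompact U) :
    ∃ C, ∀ R : L2 𝕜 g →L[𝕜] L2 𝕜 g,
      smoothSeminorm ((𝓡 d).prod (𝓡 d)) (prodMetric g) U k (sandwichKernel hA hB R) ≤
        ENNReal.ofReal (C * ‖R‖) := by
  obtain ⟨C, hC, hle⟩ := exists_smoothSeminorm_le (𝕜 := 𝕜)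
    (isSmoothMetricOn_chartMetric_prodMetric g) (contMDiff_sandwichFunctional hA hB) k hU
  have norm_eval_le (R : L2 𝕜 g →L[𝕜] L2 𝕜 g) :
      ‖(evalCLM R : ((L2 𝕜 g →L[𝕜] L2 𝕜 g) →L[𝕜] 𝕜) →L[ℝ] 𝕜)‖ ≤ ‖R‖ :=
    ContinuousLinearMap.opNorm_le_bound _ (norm_nonneg R) fun φ =>
      (φ.le_opNorm R).trans_eq (mul_comm _ _)
  exact ⟨C, fun R => (hle (evalCLM R)).trans
    (ENNReal.ofReal_le_ofReal (mul_le_mul_of_nonneg_left (norm_eval_le R) hC))⟩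

end Kernels

section NeumannSeries

theorem hasSum_pow_succ {R : Type*} [Semiring R] [TopologicalSpace R] [IsTopologicalSemiring R]
    {x q : R} (hq : HasSum (fun n : ℕ => x ^ n) q) :
    HasSum (fun n : ℕ => x ^ (n + 1)) (x + x * q * x) := by
  have hsucc : HasSum (fun n : ℕ => x ^ (n + 1 + 1)) (x * q * x) := by
    simpa only [← pow_succ', ← pow_succ] using (hq.mul_left x).mul_right x
  simpa only [zero_add, pow_one] using HasSum.zero_add (f := fun n => x ^ (n + 1)) hsucc

variable {d : ℕ} {M : Type*} [TopologicalSpace M] [ChartedSpace (EuclideanSpace ℝ (Fin d)) M]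
  [IsManifold (𝓡 d) ∞ M] [MeasurableSpace M] {𝕜 : Type*} [RCLike 𝕜] {g : Metric d M}
  {S : L2 𝕜 g →L[𝕜] L2 𝕜 g} {K : SmoothKernel 𝕜 d M}

theorem IsSmoothingKernel.pow_add_two (hS : IsSmoothingKernel g K S) (n : ℕ) :
    IsSmoothingKernel g (sandwichKernel hS hS (S ^ n)) (S ^ (n + 2)) := by
  simpa only [← pow_succ', ← pow_succ] using isSmoothingKernel_sandwichKernel hS hS (S ^ n)

theorem IsSmoothing.pow (hS : IsSmoothing g S) {n : ℕ} (hn : 1 ≤ n) : IsSmoothing g (S ^ n) := by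
  obtain ⟨K, hK⟩ := hS
  match n, hn with
  | 1, _ => exact ⟨K, by simpa only [pow_one] using hK⟩
  | n + 2, _ => exact ⟨_, hK.pow_add_two n⟩

theorem IsSmoothing.existsUnique [BorelSpace M] (hS : IsSmoothing g S) :
    ∃! K : SmoothKernel 𝕜 d M, IsSmoothingKernel g K S :=
  let ⟨K, hK⟩ := hS
  ⟨K, hK, fun _ hL => hL.unique hK⟩

variable [BorelSpace M]

theorem sum_Icc_kernel_pow (hS : IsSmoothingKernel g K S) {κ : ℕ → SmoothKernel 𝕜 d M}
    (hκ : ∀ n, 1 ≤ n → IsSmoothingKernel g (κ n) (S ^ n)) (l : ℕ) :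
    ∑ n ∈ Finset.Icc 1 (l + 1), κ n =
      K + sandwichKernel hS hS (∑ i ∈ Finset.range l, S ^ i) := by
  have kernel_one : κ 1 = K := (hκ 1 le_rfl).unique (by simpa only [pow_one] using hS)
  have kernel_add_two (i : ℕ) : κ (i + 2) = sandwichKernel hS hS (S ^ i) :=
    (hκ (i + 2) (by omega)).unique (hS.pow_add_two i)
  induction l with
  | zero => simp [kernel_one]
  | succ l ih =>
    rw [Finset.sum_Icc_succ_top (by omega), ih, kernel_add_two, Finset.sum_range_succ, map_add,
      add_assoc]

theorem tendstoSmooth_sum_kernel_pow (hS : IsSmoothingKernel g K S)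
    {κ : ℕ → SmoothKernel 𝕜 d M} (hκ : ∀ n, 1 ≤ n → IsSmoothingKernel g (κ n) (S ^ n))
    {Q : L2 𝕜 g →L[𝕜] L2 𝕜 g} (hQ : HasSum (fun n : ℕ => S ^ n) Q)
    (U : CompactExhaustion (M × M)) :
    TendstoSmooth g U (fun m => ∑ n ∈ Finset.Icc 1 m, κ n) (K + sandwichKernel hS hS Q) := by
  intro j k
  obtain ⟨C, hC⟩ := exists_smoothSeminorm_sandwichKernel_le hS hS k (U.isCompact j)
  have hbound : Tendsto (fun l : ℕ => ENNReal.ofReal (C * ‖∑ i ∈ Finset.range l, S ^ i - Q‖)) atTop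
      (𝓝 0) := by
    simpa only [mul_zero, ENNReal.ofReal_zero] using ENNReal.tendsto_ofReal
      ((tendsto_iff_norm_sub_tendsto_zero.1 hQ.tendsto_sum_nat).const_mul C)
  rw [← tendsto_add_atTop_iff_nat 1]
  refine tendsto_of_tendsto_of_tendsto_of_le_of_le tendsto_const_nhds hbound
    (fun _ => zero_le) fun l => ?_
  simp only [sum_Icc_kernel_pow hS hκ, add_sub_add_left_eq_sub, ← map_sub]
  exact hC _

end NeumannSeries

end NeumannSmoothing

end

theorem mainTheorem11_general {𝕜 : Type*} [RCLike 𝕜] {d : ℕ} {M : Type*} [TopologicalSpace M]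
    [ChartedSpace (EuclideanSpace ℝ (Fin d)) M] [IsManifold (𝓡 d) ∞ M]
    [MeasurableSpace M] [BorelSpace M] (g : NeumannSmoothing.Metric d M)
    (S : NeumannSmoothing.L2 𝕜 g →L[𝕜] NeumannSmoothing.L2 𝕜 g)
    (hS : NeumannSmoothing.IsSmoothing g S) (hsum : Summable fun n : ℕ => S ^ n) :
    (∀ n : ℕ, 1 ≤ n → ∃! K : NeumannSmoothing.SmoothKernel 𝕜 d M,
      NeumannSmoothing.IsSmoothingKernel g K (S ^ n)) ∧
    ∃ (S' : NeumannSmoothing.L2 𝕜 g →L[𝕜] NeumannSmoothing.L2 𝕜 g)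
      (K' : NeumannSmoothing.SmoothKernel 𝕜 d M),
      (1 - S) * (1 + S') = 1 ∧ (1 + S') * (1 - S) = 1 ∧
      HasSum (fun n : ℕ => S ^ (n + 1)) S' ∧
      NeumannSmoothing.IsSmoothingKernel g K' S' ∧
      ∀ K : ℕ → NeumannSmoothing.SmoothKernel 𝕜 d M,
        (∀ n : ℕ, 1 ≤ n → NeumannSmoothing.IsSmoothingKernel g (K n) (S ^ n)) →
        ∀ U : CompactExhaustion (M × M),
          NeumannSmoothing.TendstoSmooth g U (fun m => ∑ n ∈ Finset.Icc 1 m, K n) K' := by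
  refine ⟨fun n hn => (hS.pow hn).existsUnique, ?_⟩
  obtain ⟨K, hK⟩ := hS
  set Q := ∑' n : ℕ, S ^ n
  have hS' : HasSum (fun n : ℕ => S ^ (n + 1)) (S + S * Q * S) :=
    NeumannSmoothing.hasSum_pow_succ hsum.hasSum
  have hQ : 1 + (S + S * Q * S) = Q := by
    simpa only [pow_zero] using
      (HasSum.zero_add (f := fun n : ℕ => S ^ n) hS').unique hsum.hasSum
  refine ⟨S + S * Q * S, K + NeumannSmoothing.sandwichKernel hK hK Q, ?_, ?_, hS',
    hK.add (NeumannSmoothing.isSmoothingKernel_sandwichKernel hK hK Q),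
    fun κ hκ U => NeumannSmoothing.tendstoSmooth_sum_kernel_pow hK hκ hsum.hasSum U⟩
  · rw [hQ, hsum.one_sub_mul_tsum_pow]
  · rw [hQ, hsum.tsum_pow_mul_one_sub]

theorem mainTheorem11 {𝕜 : Type*} [RCLike 𝕜] {d : ℕ} {M : Type*} [TopologicalSpace M]
    [ChartedSpace (EuclideanSpace ℝ (Fin d)) M] [IsManifold (𝓡 d) ∞ M]
    [T2Space M] [SecondCountableTopology M] [MeasurableSpace M] [BorelSpace M]
    (g : NeumannSmoothing.Metric d M)
    (S : NeumannSmoothing.L2 𝕜 g →L[𝕜] NeumannSmoothing.L2 𝕜 g)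
    (hS : NeumannSmoothing.IsSmoothing g S) (hcomp : IsCompactOperator S) (hnorm : ‖S‖ < 1) :
    (∀ n : ℕ, 1 ≤ n → ∃! K : NeumannSmoothing.SmoothKernel 𝕜 d M,
      NeumannSmoothing.IsSmoothingKernel g K (S ^ n)) ∧
    ∃ (S' : NeumannSmoothing.L2 𝕜 g →L[𝕜] NeumannSmoothing.L2 𝕜 g)
      (K' : NeumannSmoothing.SmoothKernel 𝕜 d M),
      (1 - S) * (1 + S') = 1 ∧ (1 + S') * (1 - S) = 1 ∧
      HasSum (fun n : ℕ => S ^ (n + 1)) S' ∧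
      NeumannSmoothing.IsSmoothingKernel g K' S' ∧
      ∀ K : ℕ → NeumannSmoothing.SmoothKernel 𝕜 d M,
        (∀ n : ℕ, 1 ≤ n → NeumannSmoothing.IsSmoothingKernel g (K n) (S ^ n)) →
        ∀ U : CompactExhaustion (M × M),
          NeumannSmoothing.TendstoSmooth g U (fun m => ∑ n ∈ Finset.Icc 1 m, K n) K' :=
  mainTheorem11_general g S hS (summable_geometric_of_norm_lt_one hnorm)
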